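/- Let $k$ be a field, $S=k[y_1,y_2,y_3]$ with the standard grading, $f=y_1^3+y_1^2y_3-y_2^2y_3$ and $R=S/(f)$. Let $V(f)\subset\mathbb P^2_k$ be the set of $k$-rational points of the curve $f=0$, $s=(0:0:1)$ and $V(f)_{\mathrm{reg}}=V(f)\setminus\{s\}$. For $\lambda=(\lambda_1:\lambda_2:1)\in V(f)$ put \[ \varphi_\lambda=\begin{pmatrix} y_1-\lambda_1y_3 & y_2y_3+\lambda_2y_3^2\\ y_2-\lambda_2y_3 & y_1^2+(\lambda_1+1)y_1y_3+(\lambda_1^2+\lambda_1)y_3^2\end{pmatrix},\quad \psi_\lambda=\begin{pmatrix} y_1^2+(\lambda_1+1)y_1y_3+(\lambda_1^2+\lambda_1)y_3^2 & -(y_2y_3+\lambda_2y_3^2)\\ -(y_2-\lambda_2y_3) & y_1-\lambda_1y_3\end{pmatrix}, \] and for $\lambda=(0:1:0)$ (the only other point of $V(f)$) put \[ \varphi_\lambda=\begin{pmatrix} y_1+y_3 & y_2^2\\ y_3 & y_1^2\end{pmatrix},\quad \psi_\lambda=\begin{pmatrix} y_1^2 & -y_2^2\\ -y_3 & y_1+y_3\end{pmatrix}.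 \] Regard them as graded maps $\varphi_\lambda:R(-2)\oplus R(-3)\to R(-1)^2$ and $\psi_\lambda:R(-2)^2\to R\oplus R(-1)$, so that $\operatorname{Coker}\varphi_\lambda$ and $\operatorname{Coker}\psi_\lambda$ are graded $R$-modules. Let $\mathcal M_{-1}=\{\operatorname{Coker}\varphi_\lambda\mid\lambda\in V(f)_{\mathrm{reg}}\}$, $\mathcal M_1=\{\operatorname{Coker}\psi_\lambda\mid\lambda\in V(f)_{\mathrm{reg}}\}$ and $\underline{\mathcal M}=\{\operatorname{Coker}\varphi_s,\operatorname{Coker}\psi_s\}$. A graded maximal Cohen--Macaulay (MCM) $R$-module is a finitely generated $\mathbb Z$-graded $R$-module whose depth with respect to $(y_1,y_2,y_3)$ equals $\dim R$. Then: 1. For every $\lambda\in V(f)$, $(\varphi_\lambda,\psi_\lambda)$ is a graded matrix factorization of $f$: $\varphi_\lambda\psi_\lambda=\psi_\lambda\varphi_\lambda=f\cdot\mathbf 1_2$ over $S$, with homogeneous entries of the degrees prescribed by the above graded maps. 2. Every non-free graded MCM $R$-module whose minimal number of generators is two is isomorphic, as a graded module up to a shift of the grading, to a module from $\mathcal M_{-1}\cup\mathcal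 M_1\cup\underline{\mathcal M}$. 3. The modules $\operatorname{Coker}\varphi_\lambda$ and $\operatorname{Coker}\psi_\lambda$, $\lambda\in V(f)$, are pairwise non-isomorphic, even as ungraded $R$-modules; hence the module in (2) is unique. 4. All modules from $\mathcal M_{-1}\cup\mathcal M_1\cup\underline{\mathcal M}$ have rank $1$. 5. For every $\lambda\in V(f)_{\mathrm{reg}}$, $(\operatorname{Coker}\psi_\lambda)(-2)$ is, as a graded module, isomorphic to the first syzygy module (the kernel of a minimal graded free cover) of $\operatorname{Coker}\varphi_\lambda$, and $\operatorname{Coker}\psi_\lambda$ is, as a graded module, isomorphic to the dual $\operatorname{Hom}_R(\operatorname{Coker}\varphi_\lambda,R)$. -/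

import Mathlib

open scoped LinearAlgebra.Projectivization

noncomputable section

namespace SimpleNode

universe u v w

section Ring

variable (k : Type u) [Field k]

/-- The polynomial ring `S = k[y₁, y₂, y₃]`; the variables are `X 0`, `X 1`, `X 2`. -/
abbrev PolyRing : Type u := MvPolynomial (Fin 3) k

/-- The cubic form `f = y₁³ + y₁² y₃ - y₂² y₃`. -/
def cubic : PolyRing k :=
  MvPolynomial.X 0 ^ 3 + MvPolynomial.X 0 ^ 2 * MvPolynomial.X 2
    - MvPolynomial.X 1 ^ 2 * MvPolynomial.X 2

/-- The homogeneous coordinate ring `R = S / (f)` (the affine cone of the simple node). -/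
abbrev NodeRing : Type u := PolyRing k ⧸ Ideal.span {cubic k}

/-- Homogeneous polynomials of integer degree `d` (only `0` if `d < 0`). -/
def polyDeg (d : ℤ) : Submodule k (PolyRing k) :=
  if 0 ≤ d then MvPolynomial.homogeneousSubmodule (Fin 3) k d.toNat else ⊥

/-- The degree `d` component `R_d` of `R`. -/
def ringDeg (d : ℤ) : AddSubgroup (NodeRing k) :=
  (polyDeg k d).toAddSubgroup.map (Ideal.Quotient.mk (Ideal.span {cubic k})).toAddMonoidHom

/-- The irrelevant ideal `𝔪 = (y₁, y₂, y₃)` of `R`. -/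
def irrelevant : Ideal (NodeRing k) :=
  Ideal.span (Set.range fun i : Fin 3 =>
    Ideal.Quotient.mk (Ideal.span {cubic k}) (MvPolynomial.X i))

end Ring

section GradedModules

variable {k : Type u} [Field k]
variable {M : Type v} [AddCommGroup M] [Module (NodeRing k) M]
variable {N : Type w} [AddCommGroup N] [Module (NodeRing k) N]

/-- The family `gr` makes the `R`-module `M` a `ℤ`-graded `R`-module. -/
structure IsGrading (gr : ℤ → AddSubgroup M) : Prop where
  isInternal : DirectSum.IsInternal gr
  smul_mem : ∀ (i j : ℤ) (r : NodeRing k) (m : M),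
    r ∈ ringDeg k i → m ∈ gr j → r • m ∈ gr (i + j)

/-- Graded maximal Cohen-Macaulay `R`-modules: finitely generated graded modules whose depth
with respect to the irrelevant ideal equals the Krull dimension of `R`. -/
structure IsGradedMCM (gr : ℤ → AddSubgroup M) : Prop where
  isGrading : IsGrading (k := k) gr
  finite : Module.Finite (NodeRing k) M
  exists_regular : ∃ rs : List (NodeRing k),
    (∀ r ∈ rs, r ∈ irrelevant k) ∧ RingTheory.Sequence.IsRegular M rs ∧
      (rs.length : WithBot ℕ∞) = ringKrullDim (NodeRing k)

/-- There is an `R`-linear isomorphism `M ≃ N`, homogeneous of degree `d`. -/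
def GradedIso (k : Type u) [Field k] {M : Type v} [AddCommGroup M] [Module (NodeRing k) M]
    {N : Type w} [AddCommGroup N] [Module (NodeRing k) N]
    (grM : ℤ → AddSubgroup M) (grN : ℤ → AddSubgroup N) (d : ℤ) : Prop :=
  ∃ e : M ≃ₗ[NodeRing k] N, ∀ j : ℤ, (grM j).map (e : M →+ N) = grN (j + d)

/-- The grading of the free module `⨁ᵢ R(-aᵢ)`: the `i`-th basis vector has degree `aᵢ`. -/
def freeDeg (k : Type u) [Field k] {n : ℕ} (a : Fin n → ℤ) (j : ℤ) :
    AddSubgroup (Fin n → NodeRing k) :=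
  AddSubgroup.pi Set.univ fun i => ringDeg k (j - a i)

/-- The grading of the dual `Hom_R(M, R)`: its degree `j` component consists of the linear forms
which are homogeneous of degree `j`. -/
def dualDeg (k : Type u) [Field k] {M : Type v} [AddCommGroup M] [Module (NodeRing k) M]
    (gr : ℤ → AddSubgroup M) (j : ℤ) : AddSubgroup (Module.Dual (NodeRing k) M) where
  carrier := {g | ∀ i : ℤ, ∀ m ∈ gr i, g m ∈ ringDeg k (i + j)}
  zero_mem' := fun _ _ _ => zero_mem _
  add_mem' := fun hg hh i m hm => add_mem (hg i m hm) (hh i m hm)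
  neg_mem' := fun hg i m hm => neg_mem (hg i m hm)

/-- `N`, shifted so that its degree `j` component is placed in degree `j + d`, is the first syzygy
module of `M`: it is isomorphic to the kernel of a minimal graded free cover of `M`. -/
def IsFirstSyzygy (k : Type u) [Field k] {N : Type w} [AddCommGroup N] [Module (NodeRing k) N]
    {M : Type v} [AddCommGroup M] [Module (NodeRing k) M]
    (grN : ℤ → AddSubgroup N) (grM : ℤ → AddSubgroup M) (d : ℤ) : Prop :=
  ∃ (n : ℕ) (a : Fin n → ℤ) (p : (Fin n → NodeRing k) →ₗ[NodeRing k] M),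
    Function.Surjective p ∧
    (∀ (j : ℤ) (x : Fin n → NodeRing k), x ∈ freeDeg k a j → p x ∈ grM j) ∧
    LinearMap.ker p ≤ irrelevant k • (⊤ : Submodule (NodeRing k) (Fin n → NodeRing k)) ∧
    GradedIso k grN
      (fun j => (freeDeg k a j).comap (LinearMap.ker p).subtype.toAddMonoidHom) d

end GradedModules

section MatrixFactorizations

/-- `(A, B)` is a graded matrix factorization of the form `g` of degree `e`:
`A B = B A = g · 1`, where `A : ⨁ S(-bⱼ) → ⨁ S(-aᵢ)` and `B : ⨁ S(-aⱼ - e) → ⨁ S(-bᵢ)`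
are homogeneous of degree `0`. -/
structure IsGradedMatrixFactorization {k : Type u} [Field k] {n : ℕ} (g : PolyRing k) (e : ℤ)
    (a b : Fin n → ℤ) (A B : Matrix (Fin n) (Fin n) (PolyRing k)) : Prop where
  mul_eq : A * B = g • (1 : Matrix (Fin n) (Fin n) (PolyRing k))
  mul_eq' : B * A = g • (1 : Matrix (Fin n) (Fin n) (PolyRing k))
  left_mem : ∀ i j, A i j ∈ polyDeg k (b j - a i)
  right_mem : ∀ i j, B i j ∈ polyDeg k (a j + e - b i)

/-- The `R`-linear map `Rⁿ → Rⁿ` given by a matrix over `S`. -/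
def matMap {k : Type u} [Field k] {n : ℕ} (A : Matrix (Fin n) (Fin n) (PolyRing k)) :
    (Fin n → NodeRing k) →ₗ[NodeRing k] (Fin n → NodeRing k) :=
  (A.map (Ideal.Quotient.mk (Ideal.span {cubic k}))).mulVecLin

/-- The `R`-module `Coker A`. -/
abbrev Coker {k : Type u} [Field k] {n : ℕ} (A : Matrix (Fin n) (Fin n) (PolyRing k)) : Type u :=
  (Fin n → NodeRing k) ⧸ LinearMap.range (matMap A)

/-- The grading of `Coker A` as a quotient of `⨁ᵢ R(-aᵢ)`. -/
def cokerDeg {k : Type u} [Field k] {n : ℕ} (A : Matrix (Fin n) (Fin n) (PolyRing k))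
    (a : Fin n → ℤ) (j : ℤ) : AddSubgroup (Coker A) :=
  (freeDeg k a j).map (LinearMap.range (matMap A)).mkQ.toAddMonoidHom

end MatrixFactorizations

section Curve

variable (k : Type u) [Field k]

/-- The set `V(f)` of `k`-rational points of the projective plane curve `f = 0`. -/
def curve : Set (ℙ k (Fin 3 → k)) := {p | MvPolynomial.eval p.rep (cubic k) = 0}

/-- The singular point `s = (0 : 0 : 1)`. -/
def singularPt : ℙ k (Fin 3 → k) :=
  Projectivization.mk k ![0, 0, 1] (fun h => one_ne_zero (congrFun h 2))

/-- The set `V(f)_reg = V(f) \ {s}`. -/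
def curveReg : Set (ℙ k (Fin 3 → k)) := curve k \ {singularPt k}

end Curve

section Matrices

open MvPolynomial

variable {k : Type u} [Field k]

/-- The matrix `φ_λ` for `λ = (a : b : 1)`. -/
def phiAff (a b : k) : Matrix (Fin 2) (Fin 2) (PolyRing k) :=
  !![X 0 - C a * X 2, X 1 * X 2 + C b * X 2 ^ 2;
     X 1 - C b * X 2, X 0 ^ 2 + C (a + 1) * X 0 * X 2 + C (a ^ 2 + a) * X 2 ^ 2]

/-- The matrix `ψ_λ` for `λ = (a : b : 1)`. -/
def psiAff (a b : k) : Matrix (Fin 2) (Fin 2) (PolyRing k) :=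
  !![X 0 ^ 2 + C (a + 1) * X 0 * X 2 + C (a ^ 2 + a) * X 2 ^ 2, -(X 1 * X 2 + C b * X 2 ^ 2);
     -(X 1 - C b * X 2), X 0 - C a * X 2]

variable (k) in
/-- The matrix `φ_λ` for `λ = (0 : 1 : 0)`. -/
def phiInf : Matrix (Fin 2) (Fin 2) (PolyRing k) :=
  !![X 0 + X 2, X 1 ^ 2;
     X 2, X 0 ^ 2]

variable (k) in
/-- The matrix `ψ_λ` for `λ = (0 : 1 : 0)`. -/
def psiInf : Matrix (Fin 2) (Fin 2) (PolyRing k) :=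
  !![X 0 ^ 2, -X 1 ^ 2;
     -X 2, X 0 + X 2]

open Classical in
/-- The matrix `φ_p`. A point with nonzero third coordinate is written as `(a : b : 1)`;
the only point of `V(f)` with vanishing third coordinate is `(0 : 1 : 0)`. -/
def phi (p : ℙ k (Fin 3 → k)) : Matrix (Fin 2) (Fin 2) (PolyRing k) :=
  if p.rep 2 = 0 then phiInf k else phiAff (p.rep 0 / p.rep 2) (p.rep 1 / p.rep 2)

open Classical in
/-- The matrix `ψ_p`, with the same conventions as for `φ_p`. -/
def psi (p : ℙ k (Fin 3 → k)) : Matrix (Fin 2) (Fin 2) (PolyRing k) :=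
  if p.rep 2 = 0 then psiInf k else psiAff (p.rep 0 / p.rep 2) (p.rep 1 / p.rep 2)

/-- The grading of `Coker φ_p`, where `φ_p : R(-2) ⊕ R(-3) → R(-1)²`. -/
def cokerPhiDeg (p : ℙ k (Fin 3 → k)) : ℤ → AddSubgroup (Coker (phi p)) :=
  cokerDeg (phi p) ![1, 1]

/-- The grading of `Coker ψ_p`, where `ψ_p : R(-2)² → R ⊕ R(-1)`. -/
def cokerPsiDeg (p : ℙ k (Fin 3 → k)) : ℤ → AddSubgroup (Coker (psi p)) :=
  cokerDeg (psi p) ![0, 1]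

end Matrices

end SimpleNode

end

/-! Classification. Regard a two-generated graded MCM module `M` as a module over `S`. Depth at
least two over a polynomial ring in three variables forces the relation module to be free; this
instance of Auslander–Buchsbaum is proved with Koszul relations (`koszul_of_regular`, `koszul_ker`,
`linearIndependent_of_koszul`). Since `f` kills `M`, the relation module has rank two, so `M` is the
cokernel of a 2×2 matrix without constant terms. Its determinant divides `f²`, hence is `1`, `f` or
`f²` up to a unit: `1` contradicts minimality and `f²` makes `M` free, so it is `c f`
(`exists_isPres`).

Irreducibility of `f` makes all entries nonzero, and a degree count leaves two linear entries
filling a column or a row, and two quadratic ones. The linear entries are independent, and their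
common zero lies on the curve: it is the point `λ` (`exists_point`). Scalar operations bring them
into the form prescribed by `φ_λ` or `ψ_λ`; the quadratic entries are then determined up to a
multiple of the linear ones (`exists_of_det_eq`), which one more operation removes.

The other statements. `ψ_λ` is the adjugate of `φ_λ` and `det φ_λ = f`, so over `R` the kernel of
each is the image of the other (`ker_matMap`). This gives the ranks, the syzygy and, through the
determinant pairing on `R²`, the dual. An isomorphism of cokernels yields an equivalence of the
linear parts of the matrices (`exists_linPart`); these parts recover the point and tell `φ` from
`ψ`. -/

noncomputable section

namespace SimpleNode

universe u v w

open MvPolynomial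

/-! ### Homogeneous components of polynomials, in integer degrees. -/

section Components

variable {k : Type u} [Field k]

/-- The homogeneous component of integer degree `d` (zero if `d < 0`). -/
def hc (d : ℤ) : PolyRing k →ₗ[k] PolyRing k :=
  if 0 ≤ d then homogeneousComponent d.toNat else 0

lemma mem_polyDeg_natCast {n : ℕ} {s : PolyRing k} :
    s ∈ polyDeg k (n : ℤ) ↔ s.IsHomogeneous n := by
  simp [polyDeg]

lemma mem_polyDeg_of_neg {d : ℤ} (hd : d < 0) {s : PolyRing k} : s ∈ polyDeg k d ↔ s = 0 := by
  simp [polyDeg, not_le.2 hd]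

lemma hc_natCast (n : ℕ) : hc (k := k) (n : ℤ) = homogeneousComponent n := by simp [hc]

lemma hc_of_neg {d : ℤ} (hd : d < 0) : hc (k := k) d = 0 := by simp [hc, not_le.2 hd]

lemma hc_mem (d : ℤ) (s : PolyRing k) : hc d s ∈ polyDeg k d := by
  rcases lt_or_ge d 0 with hd | hd
  · simp [hc_of_neg hd]
  · lift d to ℕ using hd
    rw [hc_natCast, mem_polyDeg_natCast]
    exact homogeneousComponent_isHomogeneous _ _

lemma hc_of_mem {d : ℤ} {s : PolyRing k} (h : s ∈ polyDeg k d) (e : ℤ) :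
    hc e s = if e = d then s else 0 := by
  rcases lt_or_ge d 0 with hd | hd
  · rw [mem_polyDeg_of_neg hd] at h
    simp [h]
  · lift d to ℕ using hd
    rw [mem_polyDeg_natCast] at h
    rcases lt_or_ge e 0 with he | he
    · rw [hc_of_neg he, if_neg (by omega)]; rfl
    · lift e to ℕ using he
      rw [hc_natCast, homogeneousComponent_of_mem (n := d) h]
      simp

lemma hc_self {d : ℤ} {s : PolyRing k} (h : s ∈ polyDeg k d) : hc d s = s := by
  simp [hc_of_mem h]

lemma mem_of_hc_self {d : ℤ} {s : PolyRing k} (h : hc d s = s) : s ∈ polyDeg k d :=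
  h ▸ hc_mem d s

lemma hc_zero (s : PolyRing k) : hc 0 s = C (constantCoeff s) := by
  simpa [constantCoeff_eq] using LinearMap.congr_fun (hc_natCast (k := k) 0) s

/-- Allowing every larger `t'` lets finitely many polynomials share one index set. -/
lemma exists_sum_hc (s : PolyRing k) :
    ∃ t : Finset ℤ, ∀ t', t ⊆ t' → ∑ d ∈ t', hc d s = s := by
  refine ⟨(Finset.range (s.totalDegree + 1)).map Nat.castEmbedding, fun t' ht => ?_⟩
  rw [← Finset.sum_subset ht]
  · simp [hc_natCast, sum_homogeneousComponent]
  · intro d _ hd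
    rcases lt_or_ge d 0 with h | h
    · simp [hc_of_neg h]
    · lift d to ℕ using h
      rw [hc_natCast]
      apply homogeneousComponent_eq_zero
      simpa using hd

lemma polyDeg_mul {d e : ℤ} {s t : PolyRing k} (hs : s ∈ polyDeg k d) (ht : t ∈ polyDeg k e) :
    s * t ∈ polyDeg k (d + e) := by
  rcases lt_or_ge d 0 with hd | hd
  · simp [(mem_polyDeg_of_neg hd).1 hs]
  rcases lt_or_ge e 0 with he | he
  · simp [(mem_polyDeg_of_neg he).1 ht]
  lift d to ℕ using hd
  lift e to ℕ using he
  rw [mem_polyDeg_natCast] at hs ht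
  rw [← Nat.cast_add, mem_polyDeg_natCast]
  exact hs.mul ht

lemma hc_mul {d : ℤ} {v : PolyRing k} (hv : v ∈ polyDeg k d) (e : ℤ) (r : PolyRing k) :
    hc e (r * v) = hc (e - d) r * v := by
  obtain ⟨t, ht⟩ := exists_sum_hc r
  rw [← ht t subset_rfl, Finset.sum_mul, map_sum, map_sum, Finset.sum_mul]
  refine Finset.sum_congr rfl fun i _ => ?_
  rw [hc_of_mem (polyDeg_mul (hc_mem i r) hv), hc_of_mem (hc_mem i r)]
  by_cases h : e - d = i
  · rw [if_pos h, if_pos (by omega)]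
  · rw [if_neg h, if_neg (by omega), zero_mul]

lemma constantCoeff_of_mem {d : ℤ} (hd : d ≠ 0) {s : PolyRing k} (h : s ∈ polyDeg k d) :
    constantCoeff s = 0 := by
  have h1 := hc_of_mem h 0
  rw [hc_zero, if_neg (Ne.symm hd)] at h1
  simpa using h1

lemma degree_pos_of_mem {d : ℤ} {s : PolyRing k} (h : s ∈ polyDeg k d) (hs : s ≠ 0)
    (h0 : constantCoeff s = 0) : 0 < d := by
  by_contra hd
  rcases lt_or_eq_of_le (not_lt.1 hd) with hd | rfl
  · exact hs ((mem_polyDeg_of_neg hd).1 h)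
  · exact hs (by rw [← hc_self h, hc_zero, h0, C_0])

lemma degree_eq_of_mem {d e : ℤ} {s : PolyRing k} (hd : s ∈ polyDeg k d) (he : s ∈ polyDeg k e)
    (hs : s ≠ 0) : d = e := by
  by_contra h
  exact hs (by rw [← hc_self hd, hc_of_mem he, if_neg h])

lemma C_mem (c : k) : (C c : PolyRing k) ∈ polyDeg k 0 :=
  mem_polyDeg_natCast.2 (isHomogeneous_C _ _)

lemma X_mem (i : Fin 3) : (X i : PolyRing k) ∈ polyDeg k 1 :=
  mem_polyDeg_natCast.2 (isHomogeneous_X _ _)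

lemma C_mul_mem {d : ℤ} {s : PolyRing k} (c : k) (h : s ∈ polyDeg k d) : C c * s ∈ polyDeg k d := by
  simpa using polyDeg_mul (C_mem c) h

lemma X_mul_mem (i j : Fin 3) : (X i * X j : PolyRing k) ∈ polyDeg k 2 := polyDeg_mul (X_mem i) (X_mem j)

lemma X_sq_mem (i : Fin 3) : (X i ^ 2 : PolyRing k) ∈ polyDeg k 2 := by
  rw [sq]; exact X_mul_mem i i

lemma cubic_mem : cubic k ∈ polyDeg k 3 := by
  refine sub_mem (add_mem ?_ ?_) ?_
  · exact mem_polyDeg_natCast.2 (isHomogeneous_X_pow 0 3)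
  · exact polyDeg_mul (X_sq_mem 0) (X_mem 2)
  · exact polyDeg_mul (X_sq_mem 1) (X_mem 2)

lemma exists_of_mem_one {l : PolyRing k} (h : l ∈ polyDeg k 1) :
    ∃ α β γ : k, l = C α * X 0 + C β * X 1 + C γ * X 2 := by
  have h' : l ∈ homogeneousSubmodule (Fin 3) k 1 := mem_polyDeg_natCast.1 h
  rw [homogeneousSubmodule_one_eq_span_X, Submodule.mem_span_range_iff_exists_fun] at h'
  obtain ⟨c, rfl⟩ := h'
  exact ⟨c 0, c 1, c 2, by simp [Fin.sum_univ_three, smul_eq_C_mul]⟩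

end Components

/-! ### The cubic is prime, and its cone has dimension at least two. -/

section RingFacts

variable (k : Type u) [Field k]

/-- Eisenstein in `y₁` over `k[y₂, y₃]` at the prime `y₃`: the constant term `-y₂² y₃` is divisible
by `y₃` only once. In two variables, `X 0` and `X 1` stand for `y₂` and `y₃`. -/
lemma cubic_irreducible : Irreducible (cubic k) := by
  rw [← MulEquiv.irreducible_iff (finSuccEquiv k 2)]
  have e1 : (1 : Fin 3) = Fin.succ 0 := rfl
  have e2 : (2 : Fin 3) = Fin.succ 1 := rfl
  have key : finSuccEquiv k 2 (cubic k) = Polynomial.X ^ 3 +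
      (Polynomial.C (X 1) * Polynomial.X ^ 2 - Polynomial.C (X 0 ^ 2 * X 1)) := by
    simp only [cubic, map_sub, map_add, map_mul, map_pow, finSuccEquiv_X_zero]
    rw [e1, e2, finSuccEquiv_X_succ, finSuccEquiv_X_succ]
    ring
  rw [key]
  set g : Polynomial (MvPolynomial (Fin 2) k) :=
    Polynomial.C (X 1) * Polynomial.X ^ 2 - Polynomial.C (X 0 ^ 2 * X 1) with hg
  have hdeg : g.degree < 3 := by
    refine lt_of_le_of_lt (Polynomial.degree_sub_le _ _) (max_lt ?_ ?_)
    · exact lt_of_le_of_lt (Polynomial.degree_C_mul_X_pow_le _ _) (by norm_num)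
    · exact lt_of_le_of_lt Polynomial.degree_C_le (by norm_num)
  have hmonic : (Polynomial.X ^ 3 + g).Monic := Polynomial.monic_X_pow_add hdeg
  have hd3 : (Polynomial.X ^ 3 + g).degree = 3 := by
    rw [Polynomial.degree_add_eq_left_of_degree_lt] <;> simp [hdeg]
  have hX : Prime (X 1 : MvPolynomial (Fin 2) k) := X_prime
  have hP : (Ideal.span {(X 1 : MvPolynomial (Fin 2) k)}).IsPrime :=
    (Ideal.span_singleton_prime hX.ne_zero).2 hX
  refine Polynomial.irreducible_of_eisenstein_criterion hP ?_ ?_ ?_ ?_ hmonic.isPrimitive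
  · rw [hmonic.leadingCoeff]
    exact fun h => hP.ne_top ((Ideal.eq_top_iff_one _).2 h)
  · intro n hn
    rw [hd3] at hn
    have hn' : n < 3 := by exact_mod_cast hn
    rw [Ideal.mem_span_singleton]
    interval_cases n <;> simp [hg, Polynomial.coeff_X_pow, Polynomial.coeff_C]
  · rw [hd3]; norm_num
  · rw [Ideal.span_singleton_pow, Ideal.mem_span_singleton]
    rintro ⟨w, hw⟩
    have hw' : (X 1 : MvPolynomial (Fin 2) k) * (- X 0 ^ 2) = X 1 * (X 1 * w) := by
      simp only [hg, Polynomial.coeff_add, Polynomial.coeff_sub, Polynomial.coeff_C_zero,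
        Polynomial.coeff_C_mul, Polynomial.coeff_X_pow] at hw
      norm_num at hw
      linear_combination hw
    have h2 := mul_left_cancel₀ hX.ne_zero hw'
    have h3 : (X 1 : MvPolynomial (Fin 2) k) ∣ X 0 ^ 2 := ⟨-w, by linear_combination -h2⟩
    have h4 := X_dvd_X.1 (hX.dvd_of_dvd_pow h3)
    simp at h4

lemma cubic_prime : Prime (cubic k) := (cubic_irreducible k).prime

lemma cubic_ne_zero : cubic k ≠ 0 := (cubic_prime k).ne_zero

instance : (Ideal.span {cubic k}).IsPrime :=
  (Ideal.span_singleton_prime (cubic_ne_zero k)).2 (cubic_prime k)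

variable {k} in
lemma mk_eq_zero_iff {s : PolyRing k} :
    Ideal.Quotient.mk (Ideal.span {cubic k}) s = 0 ↔ cubic k ∣ s := by
  rw [Ideal.Quotient.eq_zero_iff_mem, Ideal.mem_span_singleton]

/-- The ring map `R → B` sending `yᵢ` to `b i`. -/
def evalHom {B : Type w} [CommRing B] [Algebra k B] (b : Fin 3 → B)
    (hb : aeval b (cubic k) = 0) : NodeRing k →+* B :=
  Ideal.Quotient.lift _ (aeval b : PolyRing k →ₐ[k] B).toRingHom (by
    intro a ha
    obtain ⟨c, rfl⟩ := Ideal.mem_span_singleton.1 ha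
    simp only [AlgHom.toRingHom_eq_coe, RingHom.coe_coe, map_mul, hb, zero_mul])

lemma evalHom_mk {B : Type w} [CommRing B] [Algebra k B] (b : Fin 3 → B)
    (hb : aeval b (cubic k) = 0) (s : PolyRing k) :
    evalHom k b hb (Ideal.Quotient.mk _ s) = aeval b s := rfl

/-- The chain is: zero, the ideal of the line over `(0 : 1 : 0)`, the ideal of the vertex. A lower
bound suffices to supply two members of a regular sequence. -/
lemma two_le_ringKrullDim : 2 ≤ ringKrullDim (NodeRing k) := by
  let g₀ := evalHom k (fun _ => (0 : k)) (by simp [cubic])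
  let g₁ := evalHom k ![(0 : Polynomial k), Polynomial.X, 0] (by simp [cubic])
  let P : Fin 3 → PrimeSpectrum (NodeRing k) :=
    ![⟨⊥, Ideal.isPrime_bot⟩, ⟨RingHom.ker g₁, RingHom.ker_isPrime _⟩,
      ⟨RingHom.ker g₀, RingHom.ker_isPrime _⟩]
  have h01 : P 0 < P 1 := by
    change (⊥ : Ideal (NodeRing k)) < RingHom.ker g₁
    rw [bot_lt_iff_ne_bot]
    intro h
    have : Ideal.Quotient.mk (Ideal.span {cubic k}) (X 0) ∈ RingHom.ker g₁ := by
      rw [RingHom.mem_ker, evalHom_mk]; simp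
    rw [h, Ideal.mem_bot, mk_eq_zero_iff] at this
    obtain ⟨d, hd⟩ := (X_prime (R := k) (i := (0 : Fin 3))).irreducible.dvd_iff.1 this |>.resolve_left
      (cubic_irreducible k).not_isUnit
    -- At `(0, 1, 1)` the form `y₁` vanishes while `f = -1`.
    have h4 := congrArg (aeval ![(0 : k), 1, 1] : PolyRing k →ₐ[k] k) hd
    simp [cubic] at h4
  have h12 : P 1 < P 2 := by
    change RingHom.ker g₁ < RingHom.ker g₀
    have hle : ∀ a, g₀ a = Polynomial.aeval (0 : k) (g₁ a) := by
      intro a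
      obtain ⟨s, rfl⟩ := Ideal.Quotient.mk_surjective a
      rw [evalHom_mk, evalHom_mk]
      change _ = ((Polynomial.aeval (0 : k)).comp (aeval ![(0 : Polynomial k), Polynomial.X, 0])) s
      congr 1
      ext i
      fin_cases i <;> simp
    refine lt_of_le_of_ne (fun a ha => ?_) fun h => ?_
    · rw [RingHom.mem_ker] at ha ⊢
      rw [hle, ha, map_zero]
    · have : Ideal.Quotient.mk (Ideal.span {cubic k}) (X 1) ∈ RingHom.ker g₁ := by
        rw [h, RingHom.mem_ker, evalHom_mk]; simp
      rw [RingHom.mem_ker, evalHom_mk] at this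
      simp at this
  let p : LTSeries (PrimeSpectrum (NodeRing k)) :=
    { length := 2
      toFun := P
      step := by
        intro i
        fin_cases i
        · exact h01
        · exact h12 }
  exact Order.LTSeries.length_le_krullDim p

end RingFacts

/-! ### Graded modules over `S` and minimal homogeneous generators. -/

section HomogProj

variable {k : Type u} [Field k]

/-- A `ℤ`-grading of an `S`-module, given by the projections onto its homogeneous components. -/
structure HomogProj (k : Type u) [Field k] (N : Type v) [AddCommGroup N] [Module (PolyRing k) N] where
  /-- The projection onto the degree `j` component. -/
  proj : ℤ → N →+ N
  proj_proj : ∀ j n, proj j (proj j n) = proj j n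
  proj_smul : ∀ (i j : ℤ) (r : PolyRing k) (n : N), proj j n = n →
    proj i (r • n) = hc (i - j) r • n
  exists_sum : ∀ n, ∃ t : Finset ℤ, ∀ t', t ⊆ t' → ∑ j ∈ t', proj j n = n

/-- The graded free module `⨁ᵢ S(-aᵢ)`. -/
def HomogProj.free {n : ℕ} (a : Fin n → ℤ) : HomogProj k (Fin n → PolyRing k) where
  proj j :=
    { toFun := fun v i => hc (j - a i) (v i)
      map_zero' := by ext1 i; simp
      map_add' := fun v w => by ext1 i; simp }
  proj_proj j v := by
    ext1 i
    exact hc_self (hc_mem _ _)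
  proj_smul i j r v hv := by
    ext1 l
    have hl : v l ∈ polyDeg k (j - a l) := mem_of_hc_self (congrFun hv l)
    change hc (i - a l) (r * v l) = hc (i - j) r * v l
    rw [hc_mul hl, sub_sub_sub_cancel_right]
  exists_sum v := by
    choose t ht using fun i => exists_sum_hc (v i)
    refine ⟨Finset.univ.biUnion fun i => (t i).map (addRightEmbedding (a i)), fun t' h => ?_⟩
    ext1 i
    rw [Finset.sum_apply]
    change ∑ j ∈ t', hc (j - a i) (v i) = v i
    have h2 := ht i (t'.map (addRightEmbedding (-a i))) fun d hd => by
      simp only [Finset.mem_map, addRightEmbedding_apply]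
      refine ⟨d + a i, h ?_, by omega⟩
      simp only [Finset.mem_biUnion, Finset.mem_univ, true_and, Finset.mem_map,
        addRightEmbedding_apply]
      exact ⟨i, d, hd, rfl⟩
    rw [Finset.sum_map] at h2
    simpa [sub_eq_add_neg] using h2

lemma HomogProj.free_proj_apply {n : ℕ} (a : Fin n → ℤ) (j : ℤ) (v : Fin n → PolyRing k)
    (i : Fin n) : (HomogProj.free a).proj j v i = hc (j - a i) (v i) := rfl

variable {N : Type v} [AddCommGroup N] [Module (PolyRing k) N]

/-- The grading of a homogeneous submodule. -/
def HomogProj.restrict (G : HomogProj k N) (K : Submodule (PolyRing k) N)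
    (hK : ∀ j, ∀ n ∈ K, G.proj j n ∈ K) : HomogProj k K where
  proj j :=
    { toFun := fun n => ⟨G.proj j n, hK j n n.2⟩
      map_zero' := Subtype.ext (map_zero _)
      map_add' := fun m n => Subtype.ext (map_add _ _ _) }
  proj_proj j n := Subtype.ext (G.proj_proj j n)
  proj_smul i j r n hn := Subtype.ext (G.proj_smul i j r n (congrArg Subtype.val hn))
  exists_sum n := by
    obtain ⟨t, ht⟩ := G.exists_sum n
    refine ⟨t, fun t' h => Subtype.ext ?_⟩
    rw [AddSubmonoidClass.coe_finsetSum]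
    exact ht t' h

lemma HomogProj.proj_sum_smul (G : HomogProj k N) {n : ℕ} {g : Fin n → N} {a : Fin n → ℤ}
    (hg : ∀ i, G.proj (a i) (g i) = g i) (c : Fin n → PolyRing k) (j : ℤ) :
    G.proj j (∑ i, c i • g i) = ∑ i, hc (j - a i) (c i) • g i := by
  rw [map_sum]
  exact Finset.sum_congr rfl fun i _ => G.proj_smul _ _ _ _ (hg i)

lemma HomogProj.exists_homogeneous_generators (G : HomogProj k N)
    [Module.Finite (PolyRing k) N] :
    ∃ (n : ℕ) (g : Fin n → N) (a : Fin n → ℤ), (∀ i, G.proj (a i) (g i) = g i) ∧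
      Submodule.span (PolyRing k) (Set.range g) = ⊤ := by
  classical
  obtain ⟨s, hs⟩ := (Module.Finite.fg_top : (⊤ : Submodule (PolyRing k) N).FG)
  choose t ht using G.exists_sum
  let T : Finset (ℤ × N) := s.biUnion fun x => (t x).image fun j => (j, G.proj j x)
  let e := T.equivFin.symm
  refine ⟨T.card, fun i => (e i).1.2, fun i => (e i).1.1, fun i => ?_, ?_⟩
  · obtain ⟨x, _, hx⟩ := Finset.mem_biUnion.1 (e i).2
    obtain ⟨j, _, hj⟩ := Finset.mem_image.1 hx
    change G.proj (e i).1.1 (e i).1.2 = (e i).1.2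
    rw [← hj]
    exact G.proj_proj _ _
  · rw [eq_top_iff, ← hs, Submodule.span_le]
    intro x hx
    rw [SetLike.mem_coe, ← ht x (t x) subset_rfl]
    refine Submodule.sum_mem _ fun j hj => Submodule.subset_span ?_
    have hT : (j, G.proj j x) ∈ T :=
      Finset.mem_biUnion.2 ⟨x, hx, Finset.mem_image.2 ⟨j, hj, rfl⟩⟩
    exact ⟨e.symm ⟨_, hT⟩, by simp⟩

/-- A finitely generated graded module has homogeneous generators all of whose relations have
coefficients in the irrelevant ideal. -/
lemma HomogProj.exists_minimal_generators (G : HomogProj k N)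
    [Module.Finite (PolyRing k) N] :
    ∃ (n : ℕ) (g : Fin n → N) (a : Fin n → ℤ), (∀ i, G.proj (a i) (g i) = g i) ∧
      Submodule.span (PolyRing k) (Set.range g) = ⊤ ∧
      ∀ c : Fin n → PolyRing k, ∑ i, c i • g i = 0 → ∀ i, constantCoeff (c i) = 0 := by
  classical
  have hex := G.exists_homogeneous_generators
  obtain ⟨g, a, hg, hspan⟩ := Nat.find_spec hex
  have hmin := fun m => Nat.find_min hex (m := m)
  generalize Nat.find hex = n at g a hg hspan hmin
  refine ⟨n, g, a, hg, hspan, fun c hc0 i => ?_⟩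
  by_contra hne
  obtain ⟨m, rfl⟩ : ∃ m, n = m + 1 := ⟨n - 1, by have := i.2; omega⟩
  refine hmin m (Nat.lt_succ_self m) ⟨g ∘ i.succAbove, a ∘ i.succAbove, fun l => hg _, ?_⟩
  -- In the degree `a i` component of the relation, the coefficient of `g i` is its nonzero constant
  -- term. So `g i` is redundant, against the minimality of the number of generators.
  have h1 := G.proj_sum_smul hg c (a i)
  rw [hc0, map_zero, Fin.sum_univ_succAbove _ i, sub_self, hc_zero] at h1
  have hgi : g i ∈ Submodule.span (PolyRing k) (Set.range (g ∘ i.succAbove)) := by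
    have h2 : g i = (C (constantCoeff (c i))⁻¹ : PolyRing k) •
        ((C (constantCoeff (c i)) : PolyRing k) • g i) := by
      rw [smul_smul, ← C_mul, inv_mul_cancel₀ hne, C_1, one_smul]
    rw [h2, eq_neg_of_add_eq_zero_left h1.symm]
    exact Submodule.smul_mem _ _ (neg_mem (Submodule.sum_mem _ fun l _ =>
      Submodule.smul_mem _ _ (Submodule.subset_span ⟨l, rfl⟩)))
  rw [eq_top_iff, ← hspan, Submodule.span_le]
  rintro _ ⟨l, rfl⟩
  rcases Fin.eq_self_or_eq_succAbove i l with rfl | ⟨l, rfl⟩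
  · exact hgi
  · exact Submodule.subset_span ⟨l, rfl⟩

end HomogProj

/-! ### Koszul relations and freeness. -/

section Koszul

variable {k : Type u} [Field k]

lemma exists_of_constantCoeff_eq_zero {s : PolyRing k} (h : constantCoeff s = 0) :
    ∃ s₀ s₁ s₂, s = X 0 * s₀ + X 1 * s₁ + X 2 * s₂ := by
  have hs : s ∈ Ideal.span (X '' (Set.univ : Set (Fin 3))) := by
    rw [mem_ideal_span_X_image]
    intro m hm
    by_contra hcon
    push Not at hcon
    have : m = 0 := by ext i; exact hcon i trivial
    rw [mem_support_iff, this] at hm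
    exact hm h
  rw [Set.image_univ, Ideal.mem_span_range_iff_exists_fun] at hs
  obtain ⟨c, rfl⟩ := hs
  exact ⟨c 0, c 1, c 2, by rw [Fin.sum_univ_three]; ring⟩

/-- Exactness of the Koszul complex of `y₁, y₂, y₃` on `S` in degree one. -/
lemma koszul_exact {h₀ h₁ h₂ : PolyRing k} (h : X 0 * h₀ + X 1 * h₁ + X 2 * h₂ = 0) :
    ∃ w₀ w₁ w₂, h₀ = X 1 * w₂ - X 2 * w₁ ∧ h₁ = X 2 * w₀ - X 0 * w₂ ∧
      h₂ = X 0 * w₁ - X 1 * w₀ := by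
  -- Multiplication by `y₁` leaves the exponents of `y₂` and `y₃` alone, so membership in the
  -- monomial ideal `(y₂, y₃)` passes from `y₁ h₀` to `h₀`.
  have hm : h₀ ∈ Ideal.span (X '' ({1, 2} : Set (Fin 3)) : Set (PolyRing k)) := by
    have hx : X 0 * h₀ ∈ Ideal.span (X '' ({1, 2} : Set (Fin 3)) : Set (PolyRing k)) := by
      rw [show X 0 * h₀ = h₁ * (- X 1) + h₂ * (-X 2) by linear_combination h]
      refine add_mem (Ideal.mul_mem_left _ _ (neg_mem (Ideal.subset_span ⟨1, by simp, rfl⟩)))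
        (Ideal.mul_mem_left _ _ (neg_mem (Ideal.subset_span ⟨2, by simp, rfl⟩)))
    rw [mem_ideal_span_X_image] at hx ⊢
    intro m hm
    have hs : Finsupp.single 0 1 + m ∈ (X 0 * h₀).support := by
      rw [mem_support_iff, coeff_X_mul]
      exact mem_support_iff.1 hm
    obtain ⟨i, hi, hne⟩ := hx _ hs
    refine ⟨i, hi, ?_⟩
    rcases hi with rfl | rfl <;> simpa using hne
  rw [Set.image_pair, Ideal.mem_span_pair] at hm
  obtain ⟨p, q, rfl⟩ := hm
  have h2 : X 1 * (h₁ + X 0 * p) = - (X 2 * (h₂ + X 0 * q)) := by linear_combination h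
  have hd : (X 1 : PolyRing k) ∣ X 2 * (h₂ + X 0 * q) := by
    rw [← dvd_neg, ← h2]
    exact dvd_mul_right _ _
  obtain ⟨w, hw⟩ := (X_prime.dvd_or_dvd hd).resolve_left (by simp [X_dvd_X])
  refine ⟨-w, -q, p, by ring, ?_, by linear_combination hw⟩
  have : X 1 * (h₁ + X 0 * p) = X 1 * (-(X 2 * w)) := by rw [h2, hw]; ring
  linear_combination mul_left_cancel₀ (X_ne_zero 1) this

/-- If the first Koszul homology of `N` vanishes, generators without relations involving units
are linearly independent. -/
lemma linearIndependent_of_koszul {N : Type v} [AddCommGroup N] [Module (PolyRing k) N]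
    (hN : ∀ h₀ h₁ h₂ : N, (X 0 : PolyRing k) • h₀ + (X 1 : PolyRing k) • h₁
        + (X 2 : PolyRing k) • h₂ = 0 →
      ∃ w₀ w₁ w₂ : N, h₀ = (X 1 : PolyRing k) • w₂ - (X 2 : PolyRing k) • w₁ ∧
        h₁ = (X 2 : PolyRing k) • w₀ - (X 0 : PolyRing k) • w₂ ∧
        h₂ = (X 0 : PolyRing k) • w₁ - (X 1 : PolyRing k) • w₀)
    {n : ℕ} {g : Fin n → N} (hspan : Submodule.span (PolyRing k) (Set.range g) = ⊤)
    (hmin : ∀ c : Fin n → PolyRing k, ∑ i, c i • g i = 0 → ∀ i, constantCoeff (c i) = 0) :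
    LinearIndependent (PolyRing k) g := by
  let T := Fintype.linearCombination (PolyRing k) g
  have hT : ∀ c, T c = ∑ i, c i • g i := fun c => Fintype.linearCombination_apply _ _ _
  have hsurj : Function.Surjective T := by
    rw [← LinearMap.range_eq_top, Fintype.range_linearCombination, hspan]
  let I : Ideal (PolyRing k) := RingHom.ker constantCoeff
  have hX : ∀ i, (X i : PolyRing k) ∈ I := fun i => by simp [I, RingHom.mem_ker]
  -- Write a relation as `∑ yᵢ cᵢ`. The images of the `cᵢ` form a Koszul cycle, hence a boundary;
  -- subtracting a lift of this boundary does not change the sum and turns the `cᵢ` into relations.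
  have hle : LinearMap.ker T ≤ I • LinearMap.ker T := by
    intro c hc
    have hc' := hmin c (by rw [← hT]; exact hc)
    choose c₀ c₁ c₂ hcc using fun i => exists_of_constantCoeff_eq_zero (hc' i)
    have hcc' : c = (X 0 : PolyRing k) • c₀ + (X 1 : PolyRing k) • c₁ + (X 2 : PolyRing k) • c₂ := by
      ext1 i; exact hcc i
    obtain ⟨w₀, w₁, w₂, h₀, h₁, h₂⟩ := hN (T c₀) (T c₁) (T c₂) (by
      rw [← map_smul, ← map_smul, ← map_smul, ← map_add, ← map_add, ← hcc']; exact hc)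
    obtain ⟨e₀, rfl⟩ := hsurj w₀
    obtain ⟨e₁, rfl⟩ := hsurj w₁
    obtain ⟨e₂, rfl⟩ := hsurj w₂
    have hdec : c = (X 0 : PolyRing k) • (c₀ - ((X 1 : PolyRing k) • e₂ - (X 2 : PolyRing k) • e₁))
        + (X 1 : PolyRing k) • (c₁ - ((X 2 : PolyRing k) • e₀ - (X 0 : PolyRing k) • e₂))
        + (X 2 : PolyRing k) • (c₂ - ((X 0 : PolyRing k) • e₁ - (X 1 : PolyRing k) • e₀)) := by
      rw [hcc']; module
    rw [hdec]
    refine add_mem (add_mem ?_ ?_) ?_ <;> refine Submodule.smul_mem_smul (hX _) ?_ <;>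
      simp only [LinearMap.mem_ker, map_sub, map_smul, h₀, h₁, h₂, sub_self]
  -- Nakayama: some `r ≡ 1` modulo `I` kills all relations. It is nonzero and `Sⁿ` is torsion-free,
  -- so there are none.
  obtain ⟨r, hr, hr0⟩ := Submodule.exists_sub_one_mem_and_smul_eq_zero_of_fg_of_le_smul I
    (LinearMap.ker T) (IsNoetherian.noetherian _) hle
  have hrne : r ≠ 0 := by
    rintro rfl
    simp [I, RingHom.mem_ker] at hr
  rw [Fintype.linearIndependent_iff]
  intro c hc i
  have h := congrFun (hr0 c (by rw [LinearMap.mem_ker, hT]; exact hc)) i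
  exact (mul_eq_zero.1 h).resolve_left hrne

end Koszul

/-! ### Depth, gradings and generator counts for `R`-modules. -/

section Presentation

variable {k : Type u} [Field k]

local notation "π" => Ideal.Quotient.mk (Ideal.span {cubic k})

lemma mk_mem_ringDeg {d : ℤ} {s : PolyRing k} (h : s ∈ polyDeg k d) : π s ∈ ringDeg k d :=
  ⟨s, h, rfl⟩

variable {M : Type v} [AddCommGroup M] [Module (NodeRing k) M]

lemma mk_smul_eq_zero {s : PolyRing k} (h : cubic k ∣ s) (m : M) : π s • m = 0 := by
  rw [mk_eq_zero_iff.2 h]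
  exact zero_smul (NodeRing k) m

/-- A regular sequence of length two in the irrelevant ideal makes the second Koszul homology
of `y₁, y₂, y₃` on `M` vanish. -/
lemma koszul_of_regular {gr : ℤ → AddSubgroup M} (h : IsGradedMCM (k := k) gr) (m : Fin 3 → M)
    (hm : ∀ i j, π (X i) • m j = π (X j) • m i) : ∃ n : M, ∀ i, m i = π (X i) • n := by
  obtain ⟨rs, hrs, hreg, hlen⟩ := h.exists_regular
  have h2 : (2 : WithBot ℕ∞) ≤ rs.length := hlen ▸ two_le_ringKrullDim k
  have h2' : 2 ≤ rs.length := by exact_mod_cast h2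
  obtain _ | ⟨r, _ | ⟨s, rs⟩⟩ := rs
  · simp at h2'
  · simp at h2'
  have hr := hrs r (by simp)
  have hs := hrs s (by simp)
  have hw := hreg.toIsWeaklyRegular
  rw [RingTheory.Sequence.isWeaklyRegular_cons_iff,
    RingTheory.Sequence.isWeaklyRegular_cons_iff] at hw
  obtain ⟨hr1, hs1, -⟩ := hw
  rw [irrelevant, Ideal.mem_span_range_iff_exists_fun] at hr hs
  obtain ⟨c, hc⟩ := hr
  obtain ⟨d, hd⟩ := hs
  -- If the required element exists, then `∑ cᵢ mᵢ` is `r` times it; it remains to divide by `r`.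
  have hn : ∀ j, π (X j) • ∑ i, c i • m i = r • m j := fun j => by
    rw [← hc, Finset.smul_sum, Finset.sum_smul]
    refine Finset.sum_congr rfl fun i _ => ?_
    rw [smul_comm, hm j i, smul_smul]
  have hn' : ∀ j, π (X j) • ∑ i, d i • m i = s • m j := fun j => by
    rw [← hd, Finset.smul_sum, Finset.sum_smul]
    refine Finset.sum_congr rfl fun i _ => ?_
    rw [smul_comm, hm j i, smul_smul]
  set n := ∑ i, c i • m i
  set n' := ∑ i, d i • m i
  have h0 : r • n' - s • n = 0 := by
    refine hr1.right_eq_zero_of_smul ?_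
    nth_rewrite 1 [← hc]
    rw [Finset.sum_smul]
    refine Finset.sum_eq_zero fun i _ => ?_
    rw [← smul_smul, smul_sub, smul_comm _ r, smul_comm _ s, hn, hn', smul_comm r s, sub_self,
      smul_zero]
  -- Since `s n = r n'` and `s` is regular on `M / r M`, the element `n` lies in `r M`.
  have hq : (Submodule.Quotient.mk n : QuotSMulTop r M) = 0 := by
    refine hs1.right_eq_zero_of_smul ?_
    rw [← Submodule.Quotient.mk_smul, ← sub_eq_zero.1 h0, Submodule.Quotient.mk_eq_zero]
    exact Submodule.smul_mem_pointwise_smul _ _ _ trivial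
  rw [Submodule.Quotient.mk_eq_zero] at hq
  obtain ⟨n₀, -, hn₀⟩ := (Submodule.mem_smul_pointwise_iff_exists _ _ _).1 hq
  refine ⟨n₀, fun i => hr1 ?_⟩
  change r • m i = r • π (X i) • n₀
  rw [← hn i, ← hn₀, smul_comm]

/-- The projections of a graded `R`-module, regarded as an `S`-module. -/
lemma exists_homogProj [Module (PolyRing k) M] (hsmul : ∀ (s : PolyRing k) (m : M), s • m = π s • m)
    {gr : ℤ → AddSubgroup M} (h : IsGrading (k := k) gr) :
    ∃ G : HomogProj k M, ∀ j m, G.proj j m = m ↔ m ∈ gr j := by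
  classical
  let := h.isInternal.chooseDecomposition
  have hmem : ∀ {j : ℤ} {m : M}, m ∈ gr j → ∀ i, (DirectSum.decompose gr m i : M) =
      if i = j then m else 0 := by
    intro j m hm i
    split_ifs with hij
    · subst hij
      exact DirectSum.decompose_of_mem_same gr hm
    · exact DirectSum.decompose_of_mem_ne gr hm (Ne.symm hij)
  refine ⟨⟨fun j =>
    { toFun := fun m => (DirectSum.decompose gr m j : M)
      map_zero' := by simp
      map_add' := by simp }, ?_, ?_, ?_⟩, ?_⟩
  · intro j m
    change (DirectSum.decompose gr (DirectSum.decompose gr m j : M) j : M) = _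
    rw [hmem (SetLike.coe_mem _), if_pos rfl]
    rfl
  · intro i j r m hm
    change (DirectSum.decompose gr m j : M) = m at hm
    change (DirectSum.decompose gr (r • m) i : M) = _
    have hmj : m ∈ gr j := hm ▸ SetLike.coe_mem _
    obtain ⟨t, ht⟩ := exists_sum_hc r
    conv_lhs => rw [← ht t subset_rfl]
    conv_rhs => rw [← ht t subset_rfl]
    rw [Finset.sum_smul, DirectSum.decompose_sum, DFinsupp.finsetSum_apply,
      AddSubmonoidClass.coe_finsetSum, map_sum, Finset.sum_smul]
    refine Finset.sum_congr rfl fun d _ => ?_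
    have hd : hc d r • m ∈ gr (d + j) := by
      rw [hsmul]
      exact h.smul_mem _ _ _ _ (mk_mem_ringDeg (hc_mem d r)) hmj
    rw [hmem hd, hc_of_mem (hc_mem d r)]
    by_cases hij : i = d + j
    · rw [if_pos hij, if_pos (by omega)]
    · rw [if_neg hij, if_neg (by omega), zero_smul]
  · intro m
    refine ⟨(DirectSum.decompose gr m).support, fun t' ht => ?_⟩
    rw [← Finset.sum_subset ht]
    · exact DirectSum.sum_support_decompose gr m
    · intro j _ hj
      change (DirectSum.decompose gr m j : M) = 0
      simpa using hj
  · intro j m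
    change (DirectSum.decompose gr m j : M) = m ↔ _
    exact ⟨fun hm => hm ▸ SetLike.coe_mem _, fun hm => by rw [hmem hm, if_pos rfl]⟩

/-- The number of generators in a generating set without relations involving units is the minimal
number of generators. -/
lemma card_eq_spanFinrank [Module.Finite (NodeRing k) M] {n : ℕ} {g : Fin n → M}
    (hspan : Submodule.span (NodeRing k) (Set.range g) = ⊤)
    (hmin : ∀ c : Fin n → PolyRing k, ∑ i, π (c i) • g i = 0 → ∀ i, constantCoeff (c i) = 0) :
    (⊤ : Submodule (NodeRing k) M).spanFinrank = n := by
  classical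
  apply le_antisymm
  · have h1 := Submodule.spanFinrank_span_le_ncard_of_finite (R := NodeRing k) (Set.finite_range g)
    rw [hspan] at h1
    refine h1.trans ?_
    rw [← Set.image_univ]
    refine (Set.ncard_image_le Set.finite_univ).trans ?_
    simp [Set.ncard_univ]
  · have hfg : (⊤ : Submodule (NodeRing k) M).FG := Module.Finite.fg_top
    obtain ⟨s, hs, hsp⟩ := hfg.exists_span_set_encard_eq_spanFinrank
    have hfin : s.Finite := Set.finite_of_encard_eq_coe hs
    lift s to Finset M using hfin
    rw [Set.encard_coe_eq_coe_finsetCard, Nat.cast_inj] at hs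
    rw [← hs]
    let e := s.equivFin.symm
    have hr : Set.range (fun i => (e i : M)) = s := by
      ext x
      constructor
      · rintro ⟨i, rfl⟩; exact (e i).2
      · intro hx; exact ⟨e.symm ⟨x, hx⟩, by simp⟩
    have h1 : ∀ i, ∃ p : Fin s.card → PolyRing k, ∑ j, π (p j) • (e j : M) = g i := by
      intro i
      have : g i ∈ Submodule.span (NodeRing k) (Set.range (fun i => (e i : M))) := by
        rw [hr, hsp]; trivial
      obtain ⟨c, hc⟩ := (Submodule.mem_span_range_iff_exists_fun _).1 this
      choose p hp using fun j => Ideal.Quotient.mk_surjective (c j)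
      exact ⟨p, by simpa only [hp] using hc⟩
    have h2 : ∀ j, ∃ q : Fin n → PolyRing k, ∑ i, π (q i) • g i = (e j : M) := by
      intro j
      have : (e j : M) ∈ Submodule.span (NodeRing k) (Set.range g) := by
        rw [hspan]; trivial
      obtain ⟨c, hc⟩ := (Submodule.mem_span_range_iff_exists_fun _).1 this
      choose p hp using fun j => Ideal.Quotient.mk_surjective (c j)
      exact ⟨p, by simpa only [hp] using hc⟩
    choose p hp using h1
    choose q hq using h2
    let P : Matrix (Fin n) (Fin s.card) (PolyRing k) := Matrix.of p
    let Q : Matrix (Fin s.card) (Fin n) (PolyRing k) := Matrix.of q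
    -- The rows of `P Q - 1` are relations among the `g i`, so their constant terms vanish. A rank
    -- count over `k` then bounds `n`.
    have hPQ : P.map constantCoeff * Q.map constantCoeff = 1 := by
      rw [← Matrix.map_mul]
      ext i l
      have h3 : ∑ l, π ((P * Q) i l - (1 : Matrix (Fin n) (Fin n) (PolyRing k)) i l) • g l = 0 := by
        simp only [map_sub, sub_smul, Finset.sum_sub_distrib]
        rw [sub_eq_zero]
        have hR : ∑ l, π ((1 : Matrix (Fin n) (Fin n) (PolyRing k)) i l) • g l = g i := by
          rw [Finset.sum_eq_single i]
          · simp
          · intro l _ hl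
            rw [Matrix.one_apply_ne (Ne.symm hl), mk_smul_eq_zero (dvd_zero _)]
          · simp
        rw [hR, ← hp i]
        simp only [Matrix.mul_apply, map_sum, map_mul, Finset.sum_smul]
        rw [Finset.sum_comm]
        refine Finset.sum_congr rfl fun j _ => ?_
        rw [← hq j, Finset.smul_sum]
        exact Finset.sum_congr rfl fun l _ => mul_smul _ _ _
      have h4 := hmin _ h3 l
      rw [map_sub, sub_eq_zero] at h4
      rw [Matrix.map_apply, h4]
      by_cases hil : i = l
      · subst hil; simp
      · simp [Matrix.one_apply_ne hil]
    have hrank : (1 : Matrix (Fin n) (Fin n) k).rank ≤ s.card := by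
      rw [← hPQ]
      refine (Matrix.rank_mul_le_left _ _).trans ((Matrix.rank_le_card_width _).trans ?_)
      simp
    simpa using hrank

end Presentation

/-! ### Square presentations of two-generated MCM modules. -/

section TwoGenerated

variable {k : Type u} [Field k]

local notation "π" => Ideal.Quotient.mk (Ideal.span {cubic k})

variable {M : Type v} [AddCommGroup M] [Module (NodeRing k) M]

/-- `M` is generated by the homogeneous elements `g₁`, `g₂` of degrees `a₁`, `a₂`, and their
relations over `S` are generated by the columns of the matrix `!![p, q; r, s]`. -/
structure IsPres (gr : ℤ → AddSubgroup M) (g₁ g₂ : M) (a₁ a₂ : ℤ) (p q r s : PolyRing k) :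
    Prop where
  left_mem : g₁ ∈ gr a₁
  right_mem : g₂ ∈ gr a₂
  span : ∀ m, ∃ u v : PolyRing k, m = π u • g₁ + π v • g₂
  rel : ∀ u v : PolyRing k, π u • g₁ + π v • g₂ = 0 ↔
    ∃ x y, u = x * p + y * q ∧ v = x * r + y * s

lemma IsPres.swap_generators {gr : ℤ → AddSubgroup M} {g₁ g₂ : M} {a₁ a₂ : ℤ}
    {p q r s : PolyRing k} (h : IsPres gr g₁ g₂ a₁ a₂ p q r s) :
    IsPres gr g₂ g₁ a₂ a₁ r s p q where
  left_mem := h.right_mem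
  right_mem := h.left_mem
  span m := by
    obtain ⟨u, v, rfl⟩ := h.span m
    exact ⟨v, u, add_comm _ _⟩
  rel u v := by
    rw [add_comm, h.rel]
    exact exists_congr fun x => exists_congr fun y => and_comm

lemma IsPres.swap_relations {gr : ℤ → AddSubgroup M} {g₁ g₂ : M} {a₁ a₂ : ℤ}
    {p q r s : PolyRing k} (h : IsPres gr g₁ g₂ a₁ a₂ p q r s) :
    IsPres gr g₁ g₂ a₁ a₂ q p s r where
  left_mem := h.left_mem
  right_mem := h.right_mem
  span := h.span
  rel u v := by
    rw [h.rel, exists_comm]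
    refine exists_congr fun x => exists_congr fun y => ?_
    rw [add_comm (y * p), add_comm (y * r)]

/-- The first Koszul homology of the relation module vanishes. -/
lemma koszul_ker [Module (PolyRing k) M] (hsmul : ∀ (s : PolyRing k) (m : M), s • m = π s • m)
    {gr : ℤ → AddSubgroup M} (h : IsGradedMCM (k := k) gr) {n : ℕ}
    (T : (Fin n → PolyRing k) →ₗ[PolyRing k] M) (hT : Function.Surjective T)
    (h₀ h₁ h₂ : LinearMap.ker T) (hh : (X 0 : PolyRing k) • h₀ + (X 1 : PolyRing k) • h₁
        + (X 2 : PolyRing k) • h₂ = 0) :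
    ∃ w₀ w₁ w₂ : LinearMap.ker T, h₀ = (X 1 : PolyRing k) • w₂ - (X 2 : PolyRing k) • w₁ ∧
        h₁ = (X 2 : PolyRing k) • w₀ - (X 0 : PolyRing k) • w₂ ∧
        h₂ = (X 0 : PolyRing k) • w₁ - (X 1 : PolyRing k) • w₀ := by
  obtain ⟨h₀, hk₀⟩ := h₀
  obtain ⟨h₁, hk₁⟩ := h₁
  obtain ⟨h₂, hk₂⟩ := h₂
  have hh' := congrArg Subtype.val hh
  choose w₀ w₁ w₂ e₀ e₁ e₂ using fun i => koszul_exact (congrFun hh' i)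
  have e₀' : h₀ = (X 1 : PolyRing k) • w₂ - (X 2 : PolyRing k) • w₁ := funext e₀
  have e₁' : h₁ = (X 2 : PolyRing k) • w₀ - (X 0 : PolyRing k) • w₂ := funext e₁
  have e₂' : h₂ = (X 0 : PolyRing k) • w₁ - (X 1 : PolyRing k) • w₀ := funext e₂
  subst e₀' e₁' e₂'
  rw [LinearMap.mem_ker, map_sub, map_smul, map_smul, sub_eq_zero, hsmul, hsmul] at hk₀ hk₁ hk₂
  -- That the `hᵢ` are relations says `yᵢ T wⱼ = yⱼ T wᵢ`, so `T wᵢ = yᵢ m`. Subtracting `yᵢ w`,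
  -- with `w` a lift of `m`, moves the `wᵢ` into the kernel and keeps their Koszul boundary.
  obtain ⟨m, hm⟩ := koszul_of_regular h ![T w₀, T w₁, T w₂] (by
    intro i j
    fin_cases i <;> fin_cases j <;> first | rfl | assumption | (symm; assumption))
  obtain ⟨w, rfl⟩ := hT m
  have m₀ := hm 0
  have m₁ := hm 1
  have m₂ := hm 2
  rw [← hsmul, ← map_smul] at m₀ m₁ m₂
  refine ⟨⟨w₀ - (X 0 : PolyRing k) • w, LinearMap.sub_mem_ker_iff.2 m₀⟩,
    ⟨w₁ - (X 1 : PolyRing k) • w, LinearMap.sub_mem_ker_iff.2 m₁⟩,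
    ⟨w₂ - (X 2 : PolyRing k) • w, LinearMap.sub_mem_ker_iff.2 m₂⟩, ?_, ?_, ?_⟩ <;>
  · apply Subtype.ext
    simp only [Submodule.coe_sub, Submodule.coe_smul]
    module

/-- `K` lies between `f S²` and `S²`, both of rank two. -/
lemma finrank_of_mul_mem (K : Submodule (PolyRing k) (Fin 2 → PolyRing k))
    {f : PolyRing k} (hf : f ≠ 0) (hK : ∀ v, f • v ∈ K) {n : ℕ} {g : Fin n → K}
    (hspan : Submodule.span (PolyRing k) (Set.range g) = ⊤)
    (hg : LinearIndependent (PolyRing k) g) : n = 2 := by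
  apply le_antisymm
  · have h1 := (hg.map' K.subtype K.ker_subtype).fintype_card_le_finrank
    simpa using h1
  · have h2 : LinearIndependent (PolyRing k)
        (fun i : Fin 2 => (⟨f • Pi.single i 1, hK _⟩ : K)) := by
      rw [Fintype.linearIndependent_iff]
      intro c hc i
      have h3 := congrFun (congrArg Subtype.val hc) i
      simp [Fin.sum_univ_two, Pi.single_apply] at h3
      fin_cases i <;> simpa [hf] using h3
    have h3 := h2.fintype_card_le_finrank
    rw [Module.finrank_eq_card_basis (Module.Basis.mk hg hspan.ge)] at h3
    simpa using h3

lemma exists_isPres {gr : ℤ → AddSubgroup M} (h : IsGradedMCM (k := k) gr)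
    (h2 : (⊤ : Submodule (NodeRing k) M).spanFinrank = 2) (hfree : ¬ Module.Free (NodeRing k) M) :
    ∃ (g₁ g₂ : M) (a₁ a₂ b₁ b₂ : ℤ) (p q r s : PolyRing k), IsPres gr g₁ g₂ a₁ a₂ p q r s ∧
      p ∈ polyDeg k (b₁ - a₁) ∧ q ∈ polyDeg k (b₂ - a₁) ∧ r ∈ polyDeg k (b₁ - a₂) ∧
      s ∈ polyDeg k (b₂ - a₂) ∧ constantCoeff p = 0 ∧ constantCoeff q = 0 ∧
      constantCoeff r = 0 ∧ constantCoeff s = 0 ∧ ∃ c : k, c ≠ 0 ∧ p * s - q * r = C c * cubic k := by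
  let iM : Module (PolyRing k) M := Module.compHom M π
  have hsmul : ∀ (s : PolyRing k) (m : M), s • m = π s • m := fun _ _ => rfl
  have : IsScalarTower (PolyRing k) (NodeRing k) M := ⟨fun s r m => by
    rw [hsmul, ← mul_smul]; rfl⟩
  have := h.finite
  have : Module.Finite (PolyRing k) M := Module.Finite.trans (NodeRing k) M
  obtain ⟨G, hG⟩ := exists_homogProj hsmul h.isGrading
  obtain ⟨n, g, a, hg, hspan, hmin⟩ := G.exists_minimal_generators
  let T := Fintype.linearCombination (PolyRing k) g
  have hT : ∀ c, T c = ∑ i, c i • g i := fun c => Fintype.linearCombination_apply _ _ _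
  have hsurj : Function.Surjective T := by
    rw [← LinearMap.range_eq_top, Fintype.range_linearCombination, hspan]
  have hspanR : Submodule.span (NodeRing k) (Set.range g) = ⊤ := by
    rw [eq_top_iff]
    intro m _
    obtain ⟨c, rfl⟩ := hsurj m
    rw [hT]
    exact Submodule.sum_mem _ fun i _ => Submodule.smul_mem _ (π (c i)) (Submodule.subset_span ⟨i, rfl⟩)
  obtain rfl : n = 2 := by rw [← h2, card_eq_spanFinrank hspanR hmin]
  have hhom : ∀ j, ∀ v ∈ LinearMap.ker T, (HomogProj.free a).proj j v ∈ LinearMap.ker T := by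
    intro j v hv
    rw [LinearMap.mem_ker, hT] at hv ⊢
    simp only [HomogProj.free_proj_apply]
    rw [← G.proj_sum_smul hg, hv, map_zero]
  obtain ⟨n', l, b, hl, hlspan, hlmin⟩ :=
    ((HomogProj.free a).restrict (LinearMap.ker T) hhom).exists_minimal_generators
  have hind := linearIndependent_of_koszul (koszul_ker hsmul h T hsurj) hlspan hlmin
  have hfK : ∀ v, cubic k • v ∈ LinearMap.ker T := fun v => by
    rw [LinearMap.mem_ker, map_smul, hsmul, mk_smul_eq_zero dvd_rfl]
  obtain rfl : n' = 2 := finrank_of_mul_mem _ (cubic_ne_zero k) hfK hlspan hind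
  have hrel : ∀ v : Fin 2 → PolyRing k, T v = 0 ↔ ∃ x y : PolyRing k, v = x • (l 0).1 + y • (l 1).1 := by
    intro v
    constructor
    · intro hv
      have h1 : (⟨v, hv⟩ : LinearMap.ker T) ∈ Submodule.span (PolyRing k) (Set.range l) := by
        rw [hlspan]; trivial
      obtain ⟨c, hc⟩ := (Submodule.mem_span_range_iff_exists_fun _).1 h1
      refine ⟨c 0, c 1, ?_⟩
      have h3 := congrArg Subtype.val hc
      simpa [Fin.sum_univ_two] using h3.symm
    · rintro ⟨x, y, rfl⟩
      rw [map_add, map_smul, map_smul, LinearMap.mem_ker.1 (l 0).2, LinearMap.mem_ker.1 (l 1).2,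
        smul_zero, smul_zero, add_zero]
  have hdeg : ∀ i j, (l j).1 i ∈ polyDeg k (b j - a i) := fun i j =>
    mem_of_hc_self (congrFun (congrArg Subtype.val (hl j)) i)
  have hcc : ∀ i j, constantCoeff ((l j).1 i) = 0 := fun i j => by
    refine hmin _ ?_ i
    rw [← hT]
    exact (l j).2
  have hpres : IsPres gr (g 0) (g 1) (a 0) (a 1) ((l 0).1 0) ((l 1).1 0) ((l 0).1 1) ((l 1).1 1) := by
    refine ⟨(hG _ _).1 (hg 0), (hG _ _).1 (hg 1), fun m => ?_, fun u v => ?_⟩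
    · obtain ⟨c, rfl⟩ := hsurj m
      exact ⟨c 0, c 1, by rw [hT, Fin.sum_univ_two]; rfl⟩
    · have h1 := hrel ![u, v]
      rw [hT, Fin.sum_univ_two] at h1
      refine h1.trans (exists_congr fun x => exists_congr fun y => ?_)
      constructor
      · intro e
        exact ⟨congrFun e 0, congrFun e 1⟩
      · rintro ⟨e₀, e₁⟩
        ext1 i
        fin_cases i
        · exact e₀
        · exact e₁
  refine ⟨_, _, _, _, b 0, b 1, _, _, _, _, hpres, hdeg _ _, hdeg _ _, hdeg _ _, hdeg _ _, hcc _ _,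
    hcc _ _, hcc _ _, hcc _ _, ?_⟩
  have cp := hcc 0 0
  have cq := hcc 0 1
  generalize (l 0).1 0 = p at *
  generalize (l 1).1 0 = q at *
  generalize (l 0).1 1 = r at *
  generalize (l 1).1 1 = s at *
  -- As `f` kills both generators, the relation matrix `A` has a partner `B = !![α, γ; β, δ]` with
  -- `A B = f · 1`, so `det A · det B = f²`.
  obtain ⟨α, β, e₁, e₂⟩ := (hpres.rel (cubic k) 0).1 (by
    rw [mk_smul_eq_zero (by simp), mk_smul_eq_zero (by simp), add_zero])
  obtain ⟨γ, δ, e₃, e₄⟩ := (hpres.rel 0 (cubic k)).1 (by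
    rw [mk_smul_eq_zero (by simp), mk_smul_eq_zero (by simp), add_zero])
  have hdet : (p * s - q * r) * (α * δ - β * γ) = cubic k ^ 2 := by
    linear_combination (-cubic k) * e₁ - (α * p + β * q) * e₄ + (γ * p + δ * q) * e₂
  obtain ⟨i, hi, u, hu⟩ := (dvd_prime_pow (cubic_prime k) 2).1 ⟨_, hdet.symm⟩
  have hdne : p * s - q * r ≠ 0 := fun h0 => by
    rw [h0, zero_mul] at hdet
    exact pow_ne_zero 2 (cubic_ne_zero k) hdet.symm
  -- Exponent 0 is excluded by the vanishing constant term of `det A`. For exponent 2, `det B` is a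
  -- unit, so `f` divides every entry of `A` and the generators form a basis over `R`.
  interval_cases i
  · exfalso
    have h1 := congrArg constantCoeff hu
    simp [cp, cq] at h1
  · obtain ⟨c, hc, e⟩ := isUnit_iff_eq_C_of_isReduced.1 (u⁻¹).isUnit
    refine ⟨c, hc.ne_zero, ?_⟩
    rw [← e, ← pow_one (cubic k), ← hu, mul_comm _ (u : PolyRing k), ← mul_assoc,
      Units.inv_mul, one_mul]
  · exfalso
    have hB : α * δ - β * γ = u := mul_left_cancel₀ hdne (hdet.trans hu.symm)
    have hdvd : ∀ t t', t * (α * δ - β * γ) = cubic k * t' → cubic k ∣ t := by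
      intro t t' ht
      rw [hB] at ht
      exact (Units.dvd_mul_right).1 ⟨t', ht⟩
    have dp := hdvd p δ (by linear_combination (-δ) * e₁ + β * e₃)
    have dq := hdvd q (-γ) (by linear_combination γ * e₁ - α * e₃)
    have dr := hdvd r (-β) (by linear_combination (-δ) * e₂ + β * e₄)
    have ds := hdvd s α (by linear_combination γ * e₂ - α * e₄)
    refine hfree (Module.Free.of_basis (Module.Basis.mk (v := g) ?_ hspanR.ge))
    rw [Fintype.linearIndependent_iff]
    intro c hc0
    obtain ⟨c', rfl⟩ : ∃ c' : Fin 2 → PolyRing k, c = fun i => π (c' i) := by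
      choose c' hc' using fun i => Ideal.Quotient.mk_surjective (c i)
      exact ⟨c', funext fun i => (hc' i).symm⟩
    rw [Fin.sum_univ_two] at hc0
    obtain ⟨x, y, ex, ey⟩ := (hpres.rel _ _).1 hc0
    intro i
    rw [mk_eq_zero_iff]
    fin_cases i
    · change cubic k ∣ c' 0
      rw [ex]
      exact dvd_add (dp.mul_left _) (dq.mul_left _)
    · change cubic k ∣ c' 1
      rw [ey]
      exact dvd_add (dr.mul_left _) (ds.mul_left _)

end TwoGenerated

/-! ### The points of the curve and their matrices. -/

section Points

variable {k : Type u} [Field k]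

lemma eval_cubic (v : Fin 3 → k) :
    eval v (cubic k) = v 0 ^ 3 + v 0 ^ 2 * v 2 - v 1 ^ 2 * v 2 := by
  simp [cubic]

lemma mem_curve_iff {p : ℙ k (Fin 3 → k)} : p ∈ curve k ↔
    p.rep 0 ^ 3 + p.rep 0 ^ 2 * p.rep 2 - p.rep 1 ^ 2 * p.rep 2 = 0 := by
  rw [← eval_cubic]; rfl

/-- The point `(a : b : 1)`. -/
def affPt (a b : k) : ℙ k (Fin 3 → k) :=
  Projectivization.mk k ![a, b, 1] (fun h => one_ne_zero (congrFun h 2))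

variable (k) in
/-- The point `(0 : 1 : 0)`. -/
def infPt : ℙ k (Fin 3 → k) :=
  Projectivization.mk k ![0, 1, 0] (fun h => one_ne_zero (congrFun h 1))

lemma affPt_rep (a b : k) : ∃ c : k, c ≠ 0 ∧ (affPt a b).rep = ![c * a, c * b, c] := by
  obtain ⟨c, hc⟩ := Projectivization.exists_smul_eq_mk_rep k ![a, b, 1]
    (fun h => one_ne_zero (congrFun h 2))
  refine ⟨c, c.ne_zero, ?_⟩
  rw [affPt, ← hc]
  ext i
  fin_cases i <;> simp [Units.smul_def]

variable (k) in
lemma infPt_rep : ∃ c : k, c ≠ 0 ∧ (infPt k).rep = ![0, c, 0] := by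
  obtain ⟨c, hc⟩ := Projectivization.exists_smul_eq_mk_rep k ![(0 : k), 1, 0]
    (fun h => one_ne_zero (congrFun h 1))
  refine ⟨c, c.ne_zero, ?_⟩
  rw [infPt, ← hc]
  ext i
  fin_cases i <;> simp [Units.smul_def]

lemma phi_affPt (a b : k) : phi (affPt a b) = phiAff a b := by
  obtain ⟨c, hc, h⟩ := affPt_rep a b
  simp [phi, h, hc]

variable (k) in
lemma phi_infPt : phi (infPt k) = phiInf k := by
  obtain ⟨c, hc, h⟩ := infPt_rep k
  simp [phi, h]

variable (k) in
lemma infPt_mem : infPt k ∈ curve k := by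
  obtain ⟨c, hc, h⟩ := infPt_rep k
  simp [mem_curve_iff, h]

lemma affPt_mem_iff {a b : k} : affPt a b ∈ curve k ↔ b ^ 2 = a ^ 3 + a ^ 2 := by
  obtain ⟨c, hc, h⟩ := affPt_rep a b
  rw [mem_curve_iff, h]
  simp only [Matrix.cons_val]
  rw [show (c * a) ^ 3 + (c * a) ^ 2 * c - (c * b) ^ 2 * c = c ^ 3 * (a ^ 3 + a ^ 2 - b ^ 2) by ring,
    mul_eq_zero, sub_eq_zero]
  simp [hc, eq_comm (a := b ^ 2)]

/-- The points of the curve are `(0 : 1 : 0)` and the points `(a : b : 1)` with `b² = a³ + a²`. -/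
lemma eq_infPt_or_affPt {p : ℙ k (Fin 3 → k)} (hp : p ∈ curve k) :
    p = infPt k ∨ ∃ a b : k, b ^ 2 = a ^ 3 + a ^ 2 ∧ p = affPt a b := by
  by_cases h2 : p.rep 2 = 0
  · left
    have h0 : p.rep 0 = 0 := by
      have := hp
      rw [mem_curve_iff, h2] at this
      simpa using this
    rw [infPt, ← p.mk_rep, Projectivization.mk_eq_mk_iff']
    refine ⟨p.rep 1, ?_⟩
    ext i
    fin_cases i <;> simp [h0, h2]
  · right
    have h : p = affPt (p.rep 0 / p.rep 2) (p.rep 1 / p.rep 2) := by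
      conv_lhs => rw [← p.mk_rep]
      rw [affPt, Projectivization.mk_eq_mk_iff']
      refine ⟨p.rep 2, ?_⟩
      ext i
      fin_cases i <;> simp [mul_div_cancel₀ _ h2]
    exact ⟨_, _, affPt_mem_iff.1 (h ▸ hp), h⟩

/-- Both matrix factorization identities thereby reduce to `det φ_p = f`. -/
lemma psi_eq_adjugate (p : ℙ k (Fin 3 → k)) : psi p = (phi p).adjugate := by
  rw [phi, psi]
  split_ifs <;> rw [Matrix.adjugate_fin_two]
  · simp [phiInf, psiInf]
  · simp [phiAff, psiAff]

lemma det_phi {p : ℙ k (Fin 3 → k)} (hp : p ∈ curve k) : (phi p).det = cubic k := by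
  rcases eq_infPt_or_affPt hp with rfl | ⟨a, b, hab, rfl⟩
  · rw [phi_infPt, Matrix.det_fin_two]
    simp [phiInf, cubic]
    ring
  · have hab' : (C b ^ 2 : PolyRing k) = C a ^ 3 + C a ^ 2 := by
      simp only [← map_pow, ← map_add, hab]
    rw [phi_affPt, Matrix.det_fin_two]
    simp only [phiAff, cubic, Matrix.of_apply, Matrix.cons_val', Matrix.cons_val_zero,
      Matrix.cons_val_one, Matrix.cons_val_fin_one, map_add, map_pow, map_one]
    linear_combination X 2 ^ 3 * hab'

lemma phi_mem {p : ℙ k (Fin 3 → k)} (hp : p ∈ curve k) (i j : Fin 2) :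
    phi p i j ∈ polyDeg k (![1, 2] j) := by
  rcases eq_infPt_or_affPt hp with rfl | ⟨a, b, hab, rfl⟩
  · rw [phi_infPt]
    fin_cases i <;> fin_cases j
    · exact add_mem (X_mem 0) (X_mem 2)
    · exact X_sq_mem 1
    · exact X_mem 2
    · exact X_sq_mem 0
  · rw [phi_affPt]
    fin_cases i <;> fin_cases j
    · exact sub_mem (X_mem 0) (C_mul_mem _ (X_mem 2))
    · exact add_mem (X_mul_mem 1 2) (C_mul_mem _ (X_sq_mem 2))
    · exact sub_mem (X_mem 1) (C_mul_mem _ (X_mem 2))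
    · refine add_mem (add_mem (X_sq_mem 0) ?_) (C_mul_mem _ (X_sq_mem 2))
      change _ * _ * _ ∈ _
      rw [mul_assoc]
      exact C_mul_mem _ (X_mul_mem 0 2)

end Points

/-! ### From the entries of a matrix of determinant `c f` to a point. -/

section Factor

variable {k : Type u} [Field k]

/-- Neither factor is a unit. This excludes vanishing entries and proportional linear entries. -/
lemma cubic_no_factor {x y : PolyRing k} {c : k} (hc : c ≠ 0) (h : x * y = C c * cubic k)
    (hx : constantCoeff x = 0) (hy : constantCoeff y = 0) : False := by
  have h1 : cubic k = x * (C c⁻¹ * y) := by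
    rw [mul_left_comm, h, ← mul_assoc, ← C_mul, inv_mul_cancel₀ hc, C_1, one_mul]
  rcases (cubic_irreducible k).isUnit_or_isUnit h1 with h2 | h2
  · have := h2.map (constantCoeff (σ := Fin 3) (R := k))
    simp [hx] at this
  · have := h2.map (constantCoeff (σ := Fin 3) (R := k))
    simp [hy] at this

/-- The quadratic entries of a matrix factorization are determined by the linear ones, up to a
multiple of the latter. -/
lemma exists_of_det_eq {l l' q₁ q₂ r₁ r₂ : PolyRing k} {c : k} (hl : l ∈ polyDeg k 1)
    (hl' : l' ∈ polyDeg k 1) (hq₁ : q₁ ∈ polyDeg k 2) (hq₂ : q₂ ∈ polyDeg k 2)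
    (hr₁ : r₁ ∈ polyDeg k 2) (hr₂ : r₂ ∈ polyDeg k 2)
    (hq : l * q₂ - q₁ * l' = cubic k) (hr : l * r₂ - r₁ * l' = C c * cubic k) :
    ∃ t ∈ polyDeg k 1, r₁ = C c * q₁ + t * l ∧ r₂ = C c * q₂ + t * l' := by
  have hne : l' ≠ 0 := by
    rintro rfl
    refine cubic_no_factor (x := l) (y := q₂) (c := 1) one_ne_zero ?_
      (constantCoeff_of_mem (by norm_num) hl) (constantCoeff_of_mem (by norm_num) hq₂)
    rw [C_1, ← hq]
    ring
  have hnd : ¬ cubic k ∣ l' := by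
    rintro ⟨t, rfl⟩
    have h1 := hc_self hl'
    rw [mul_comm, hc_mul cubic_mem, hc_of_neg (by norm_num)] at h1
    exact hne (by rw [mul_comm, ← h1]; simp)
  have h1 : l * (r₂ - C c * q₂) = l' * (r₁ - C c * q₁) := by linear_combination hr - C c * hq
  -- The prime `f` does not divide `l'`, for degree reasons, so it divides the second factor; the
  -- quotient `t` is the multiplier sought.
  have h2 : l' * ((r₁ - C c * q₁) * q₂ - (r₂ - C c * q₂) * q₁) = cubic k * (r₂ - C c * q₂) := by
    rw [← hq]
    linear_combination -q₂ * h1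
  obtain ⟨t, ht⟩ := ((cubic_prime k).dvd_or_dvd ⟨_, h2⟩).resolve_left hnd
  have h3 : r₂ - C c * q₂ = t * l' := by
    rw [ht] at h2
    refine mul_left_cancel₀ (cubic_ne_zero k) ?_
    linear_combination -h2
  have h4 : r₁ - C c * q₁ = t * l := by
    refine mul_left_cancel₀ hne ?_
    rw [← h1, h3]
    ring
  -- In both identities only the degree one component of `t` contributes; a homogeneous multiplier
  -- keeps the later row operation graded.
  refine ⟨hc 1 t, hc_mem _ _, ?_, ?_⟩
  · have h5 := hc_self (sub_mem hr₁ (C_mul_mem c hq₁))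
    rw [h4, hc_mul hl, show (2 - 1 : ℤ) = 1 by norm_num] at h5
    rw [h5]
    linear_combination h4
  · have h5 := hc_self (sub_mem hr₂ (C_mul_mem c hq₂))
    rw [h3, hc_mul hl', show (2 - 1 : ℤ) = 1 by norm_num] at h5
    rw [h5]
    linear_combination h3

/-- The linear entries of a matrix factorization of `f` define a point of the curve. -/
lemma exists_point {l₁ l₂ q₁ q₂ : PolyRing k} {c : k} (hc : c ≠ 0) (h₁ : l₁ ∈ polyDeg k 1)
    (h₂ : l₂ ∈ polyDeg k 1) (hq₁ : constantCoeff q₁ = 0) (hq₂ : constantCoeff q₂ = 0)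
    (h : l₁ * q₂ - q₁ * l₂ = C c * cubic k) :
    ∃ p ∈ curve k, ∃ e f g h : k, e * h - f * g ≠ 0 ∧ C e * l₁ + C f * l₂ = phi p 0 0 ∧
      C g * l₁ + C h * l₂ = phi p 1 0 := by
  have cl₁ := constantCoeff_of_mem (by norm_num) h₁
  have hprop : ∀ μ : k, l₂ ≠ C μ * l₁ := by
    rintro μ rfl
    refine cubic_no_factor hc (x := l₁) (y := q₂ - C μ * q₁) ?_ cl₁ (by simp [hq₁, hq₂])
    rw [← h]; ring
  have hl₁ : l₁ ≠ 0 := by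
    rintro rfl
    refine cubic_no_factor hc (x := -q₁) (y := l₂) ?_ (by simp [hq₁])
      (constantCoeff_of_mem (by norm_num) h₂)
    rw [← h]; ring
  obtain ⟨α₁, β₁, γ₁, rfl⟩ := exists_of_mem_one h₁
  obtain ⟨α₂, β₂, γ₂, rfl⟩ := exists_of_mem_one h₂
  -- A common zero of the two linear forms is a zero of the determinant, hence of `f`.
  have hev : ∀ v : Fin 3 → k, α₁ * v 0 + β₁ * v 1 + γ₁ * v 2 = 0 →
      α₂ * v 0 + β₂ * v 1 + γ₂ * v 2 = 0 → v 0 ^ 3 + v 0 ^ 2 * v 2 - v 1 ^ 2 * v 2 = 0 := by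
    intro v e₁ e₂
    have h3 := congrArg (eval v) h
    rw [map_sub, map_mul, map_mul, map_mul, eval_cubic] at h3
    simp only [map_add, map_mul, eval_C, eval_X, e₁, e₂, zero_mul, mul_zero, sub_zero] at h3
    exact (mul_eq_zero.1 h3.symm).resolve_left hc
  have hlin : ∀ e f : k, (C e * (C α₁ * X 0 + C β₁ * X 1 + C γ₁ * X 2) +
      C f * (C α₂ * X 0 + C β₂ * X 1 + C γ₂ * X 2) : PolyRing k) =
      C (e * α₁ + f * α₂) * X 0 + C (e * β₁ + f * β₂) * X 1 + C (e * γ₁ + f * γ₂) * X 2 := by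
    intro e f
    simp only [C_add, C_mul]
    ring
  -- The common zero is the cross product of the coefficient vectors, with third coordinate `D`. If
  -- `D = 0`, the equation of the curve leaves only `(0 : 1 : 0)`.
  by_cases hD : α₁ * β₂ - α₂ * β₁ = 0
  · have hp₁ : β₁ * γ₂ - β₂ * γ₁ = 0 := by
      have h3 := hev ![β₁ * γ₂ - β₂ * γ₁, γ₁ * α₂ - γ₂ * α₁, 0]
        (by simp only [Matrix.cons_val]; linear_combination -γ₁ * hD)
        (by simp only [Matrix.cons_val]; linear_combination -γ₂ * hD)
      simpa using h3
    have hp₂ : γ₁ * α₂ - γ₂ * α₁ ≠ 0 := by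
      intro hp₂
      by_cases hα : α₁ = 0
      · by_cases hβ : β₁ = 0
        · by_cases hγ : γ₁ = 0
          · simp [hα, hβ, hγ] at hl₁
          · apply hprop (γ₂ / γ₁)
            simp only [hα, hβ, zero_mul, mul_zero, zero_sub, sub_zero, neg_eq_zero, mul_eq_zero, hγ,
              false_or, or_false] at hp₁ hp₂
            simp [hα, hβ, hp₁, hp₂, ← mul_assoc, ← C_mul, hγ]
        · apply hprop (β₂ / β₁)
          have e₁ : α₂ = 0 := by simpa [hα, hβ] using hD
          have e₂ : γ₂ = β₂ / β₁ * γ₁ := by field_simp; linear_combination hp₁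
          simp only [mul_add, ← mul_assoc, ← C_mul, ← e₂, hα, e₁, div_mul_cancel₀ _ hβ]
          simp
      · apply hprop (α₂ / α₁)
        have e₁ : β₂ = α₂ / α₁ * β₁ := by field_simp; linear_combination hD
        have e₂ : γ₂ = α₂ / α₁ * γ₁ := by field_simp; linear_combination -hp₂
        simp only [mul_add, ← mul_assoc, ← C_mul, ← e₁, ← e₂, div_mul_cancel₀ _ hα]
    have hβ₁ : β₁ = 0 := by
      refine (mul_eq_zero.1 (?_ : (γ₁ * α₂ - γ₂ * α₁) * β₁ = 0)).resolve_left hp₂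
      linear_combination -γ₁ * hD - α₁ * hp₁
    have hβ₂ : β₂ = 0 := by
      refine (mul_eq_zero.1 (?_ : (γ₁ * α₂ - γ₂ * α₁) * β₂ = 0)).resolve_left hp₂
      linear_combination -γ₂ * hD - α₂ * hp₁
    subst hβ₁ hβ₂
    set E := γ₁ * α₂ - γ₂ * α₁ with hE
    -- Cramer's rule expresses `y₁ + y₃` and `y₃` through the two forms, which no longer involve
    -- `y₂`.
    refine ⟨infPt k, infPt_mem k, -(γ₂ - α₂) / E,
      -(α₁ - γ₁) / E, α₂ / E,
      -α₁ / E, ?_, ?_, ?_⟩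
    · have : -(γ₂ - α₂) / E * (-α₁ / E) -
          -(α₁ - γ₁) / E * (α₂ / E) =
          -1 / E := by field_simp; rw [hE]; ring
      rw [this]
      exact div_ne_zero (by simp) hp₂
    · rw [hlin, phi_infPt,
        show -(γ₂ - α₂) / E * α₁ + -(α₁ - γ₁) / E * α₂ = 1 by
          field_simp; rw [hE]; ring,
        show -(γ₂ - α₂) / E * γ₁ + -(α₁ - γ₁) / E * γ₂ = 1 by
          field_simp; rw [hE]; ring]
      simp [phiInf]
    · rw [hlin, phi_infPt,
        show α₂ / E * α₁ + -α₁ / E * α₂ = 0 by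
          field_simp; ring,
        show α₂ / E * γ₁ + -α₁ / E * γ₂ = 1 by
          field_simp; rw [hE]; ring]
      simp [phiInf]
  · set D := α₁ * β₂ - α₂ * β₁ with hDdef
    -- These are the affine coordinates of the cross product; the scalars below again come from
    -- Cramer's rule.
    let a := (β₁ * γ₂ - β₂ * γ₁) / D
    let b := (α₂ * γ₁ - α₁ * γ₂) / D
    have hab : b ^ 2 = a ^ 3 + a ^ 2 := by
      have h3 := hev ![a, b, 1]
        (by simp only [Matrix.cons_val, a, b]; field_simp; rw [hDdef]; ring)
        (by simp only [Matrix.cons_val, a, b]; field_simp; rw [hDdef]; ring)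
      simp only [Matrix.cons_val] at h3
      linear_combination -h3
    refine ⟨affPt a b, affPt_mem_iff.2 hab, β₂ / D, -β₁ / D, -α₂ / D, α₁ / D, ?_, ?_, ?_⟩
    · have : β₂ / D * (α₁ / D) - -β₁ / D * (-α₂ / D) = 1 / D := by
        field_simp; rw [hDdef]; ring
      rw [this]
      exact div_ne_zero one_ne_zero hD
    · rw [hlin, phi_affPt,
        show β₂ / D * α₁ + -β₁ / D * α₂ = 1 by field_simp; rw [hDdef]; ring,
        show β₂ / D * β₁ + -β₁ / D * β₂ = 0 by field_simp; ring,
        show β₂ / D * γ₁ + -β₁ / D * γ₂ = -a by simp only [a]; field_simp; ring]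
      simp [phiAff, sub_eq_add_neg]
    · rw [hlin, phi_affPt,
        show -α₂ / D * α₁ + α₁ / D * α₂ = 0 by field_simp; ring,
        show -α₂ / D * β₁ + α₁ / D * β₂ = 1 by field_simp; rw [hDdef]; ring,
        show -α₂ / D * γ₁ + α₁ / D * γ₂ = -b by simp only [b]; field_simp; ring]
      simp [phiAff, sub_eq_add_neg]

end Factor

/-! ### Normal forms of the presentation matrix. -/

section Classification

variable {k : Type u} [Field k]

local notation "π" => Ideal.Quotient.mk (Ideal.span {cubic k})

lemma matMap_mk {n : ℕ} (A : Matrix (Fin n) (Fin n) (PolyRing k)) (v : Fin n → PolyRing k) :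
    matMap A (fun i => π (v i)) = fun i => π (A.mulVec v i) := by
  ext1 i
  simp [matMap, Matrix.mulVec, dotProduct]

lemma exists_lift {n : ℕ} (v : Fin n → NodeRing k) : ∃ w : Fin n → PolyRing k, v = fun i => π (w i) := by
  choose w hw using fun i => Ideal.Quotient.mk_surjective (v i)
  exact ⟨w, funext fun i => (hw i).symm⟩

variable {M : Type v} [AddCommGroup M] [Module (NodeRing k) M] {gr : ℤ → AddSubgroup M}

/-- Column operations on a presentation matrix. -/
lemma IsPres.change_relations {g₁ g₂ : M} {a₁ a₂ : ℤ} {p q r s : PolyRing k}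
    (h : IsPres gr g₁ g₂ a₁ a₂ p q r s) (d x₁ x₂ y₁ y₂ : PolyRing k)
    (hd : d * (x₁ * y₂ - x₂ * y₁) = 1) :
    IsPres gr g₁ g₂ a₁ a₂ (x₁ * p + x₂ * q) (y₁ * p + y₂ * q) (x₁ * r + x₂ * s)
      (y₁ * r + y₂ * s) where
  left_mem := h.left_mem
  right_mem := h.right_mem
  span := h.span
  rel u v := by
    rw [h.rel]
    constructor
    · rintro ⟨x, y, rfl, rfl⟩
      refine ⟨d * (y₂ * x - y₁ * y), d * (x₁ * y - x₂ * x), ?_, ?_⟩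
      · linear_combination -(x * p + y * q) * hd
      · linear_combination -(x * r + y * s) * hd
    · rintro ⟨x, y, rfl, rfl⟩
      exact ⟨x * x₁ + y * y₁, x * x₂ + y * y₂, by ring, by ring⟩

/-- Row operations on a presentation matrix. -/
lemma IsPres.change_generators {g₁ g₂ : M} {a₁ a₂ : ℤ} {p q r s : PolyRing k}
    (h : IsPres gr g₁ g₂ a₁ a₂ p q r s) (d x₁ x₂ y₁ y₂ : PolyRing k)
    (hd : d * (x₁ * y₂ - x₂ * y₁) = 1) {b₁ b₂ : ℤ}
    (h₁ : π (d * y₂) • g₁ + π (-(d * y₁)) • g₂ ∈ gr b₁)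
    (h₂ : π (-(d * x₂)) • g₁ + π (d * x₁) • g₂ ∈ gr b₂) :
    IsPres gr (π (d * y₂) • g₁ + π (-(d * y₁)) • g₂) (π (-(d * x₂)) • g₁ + π (d * x₁) • g₂) b₁ b₂
      (x₁ * p + x₂ * r) (x₁ * q + x₂ * s) (y₁ * p + y₂ * r) (y₁ * q + y₂ * s) := by
  -- `d` is the inverse determinant of `!![x₁, x₂; y₁, y₂]`, and the new generators are read off the
  -- columns of the inverse matrix.
  have key : ∀ u v : PolyRing k, π u • (π (d * y₂) • g₁ + π (-(d * y₁)) • g₂) +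
      π v • (π (-(d * x₂)) • g₁ + π (d * x₁) • g₂) =
      π (d * (y₂ * u - x₂ * v)) • g₁ + π (d * (x₁ * v - y₁ * u)) • g₂ := by
    intro u v
    simp only [map_mul, map_sub, map_neg]
    module
  refine ⟨h₁, h₂, fun m => ?_, fun u v => ?_⟩
  · obtain ⟨u, v, rfl⟩ := h.span m
    refine ⟨x₁ * u + x₂ * v, y₁ * u + y₂ * v, ?_⟩
    rw [key, show d * (y₂ * (x₁ * u + x₂ * v) - x₂ * (y₁ * u + y₂ * v)) = u by
      linear_combination u * hd, show d * (x₁ * (y₁ * u + y₂ * v) - y₁ * (x₁ * u + x₂ * v)) = v by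
      linear_combination v * hd]
  · rw [key, h.rel]
    refine exists_congr fun x => exists_congr fun y => ⟨?_, ?_⟩
    · rintro ⟨e₁, e₂⟩
      constructor
      · linear_combination (-u) * hd + x₁ * e₁ + x₂ * e₂
      · linear_combination (-v) * hd + y₁ * e₁ + y₂ * e₂
    · rintro ⟨rfl, rfl⟩
      constructor
      · linear_combination (x * p + y * q) * hd
      · linear_combination (x * r + y * s) * hd

/-- The relations identify `M` with `Coker A`. The gradings agree up to the common offset `c`,
because the coordinates of a homogeneous element may be replaced by their components of the right
degree. -/
lemma IsPres.gradedIso (hgr : IsGrading (k := k) gr) {g₁ g₂ : M} {a₁ a₂ : ℤ}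
    {A : Matrix (Fin 2) (Fin 2) (PolyRing k)}
    (h : IsPres gr g₁ g₂ a₁ a₂ (A 0 0) (A 0 1) (A 1 0) (A 1 1)) (a : Fin 2 → ℤ) (c : ℤ)
    (h₁ : a₁ = a 0 + c) (h₂ : a₂ = a 1 + c) : GradedIso k gr (cokerDeg A a) (-c) := by
  subst h₁ h₂
  let L : (Fin 2 → NodeRing k) →ₗ[NodeRing k] M := Fintype.linearCombination (NodeRing k) ![g₁, g₂]
  have hL : ∀ v, L v = v 0 • g₁ + v 1 • g₂ := fun v => by
    simp [L, Fintype.linearCombination_apply, Fin.sum_univ_two]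
  have hsurj : Function.Surjective L := fun m => by
    obtain ⟨u, v, rfl⟩ := h.span m
    exact ⟨![π u, π v], by rw [hL]; rfl⟩
  have hker : LinearMap.range (matMap A) = LinearMap.ker L := by
    ext v
    obtain ⟨w, rfl⟩ := exists_lift v
    rw [LinearMap.mem_ker, hL, h.rel]
    constructor
    · rintro ⟨x, hx⟩
      obtain ⟨y, rfl⟩ := exists_lift x
      rw [matMap_mk] at hx
      rw [← h.rel]
      have e : ∀ i, π (w i) = π (A.mulVec y i) := fun i => (congrFun hx i).symm
      rw [e, e, h.rel]
      exact ⟨y 0, y 1, by simp [Matrix.mulVec, dotProduct, Fin.sum_univ_two, mul_comm],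
        by simp [Matrix.mulVec, dotProduct, Fin.sum_univ_two, mul_comm]⟩
    · rintro ⟨x, y, hx, hy⟩
      refine ⟨fun i => π (![x, y] i), ?_⟩
      rw [matMap_mk]
      ext1 i
      fin_cases i
      · simp [hx, Matrix.mulVec, dotProduct, Fin.sum_univ_two, mul_comm]
      · simp [hy, Matrix.mulVec, dotProduct, Fin.sum_univ_two, mul_comm]
  let e : Coker A ≃ₗ[NodeRing k] M :=
    (Submodule.quotEquivOfEq _ _ hker).trans (L.quotKerEquivOfSurjective hsurj)
  have he : ∀ v, e (Submodule.mkQ _ v) = L v := fun v => rfl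
  let iM : Module (PolyRing k) M := Module.compHom M π
  have hsmul : ∀ (s : PolyRing k) (m : M), s • m = π s • m := fun _ _ => rfl
  obtain ⟨G, hG⟩ := exists_homogProj hsmul hgr
  refine ⟨e.symm, fun j => ?_⟩
  ext x
  constructor
  · rintro ⟨m, hm, rfl⟩
    obtain ⟨u, v, hmuv⟩ := h.span m
    refine ⟨![π (hc (j - (a 0 + c)) u), π (hc (j - (a 1 + c)) v)], ?_, ?_⟩
    · intro i _
      fin_cases i
      · refine mk_mem_ringDeg ?_
        change _ ∈ polyDeg k (j + -c - a 0)
        rw [show j + -c - a 0 = j - (a 0 + c) by ring]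
        exact hc_mem _ _
      · refine mk_mem_ringDeg ?_
        change _ ∈ polyDeg k (j + -c - a 1)
        rw [show j + -c - a 1 = j - (a 1 + c) by ring]
        exact hc_mem _ _
    · change Submodule.mkQ _ _ = e.symm m
      rw [LinearEquiv.eq_symm_apply, he, hL]
      have h1 := (hG j m).2 hm
      rw [hmuv, map_add, ← hsmul, ← hsmul, G.proj_smul _ (a 0 + c) _ _ ((hG _ _).2 h.left_mem),
        G.proj_smul _ (a 1 + c) _ _ ((hG _ _).2 h.right_mem), hsmul, hsmul, hsmul, hsmul,
        ← hmuv] at h1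
      exact h1
  · rintro ⟨v, hv, rfl⟩
    refine ⟨e (Submodule.mkQ _ v), ?_, e.symm_apply_apply _⟩
    rw [he, hL]
    refine add_mem ?_ ?_
    · have h1 := hgr.smul_mem _ _ _ _ (hv 0 trivial) h.left_mem
      rwa [show j + -c - a 0 + (a 0 + c) = j by ring] at h1
    · have h1 := hgr.smul_mem _ _ _ _ (hv 1 trivial) h.right_mem
      rwa [show j + -c - a 1 + (a 1 + c) = j by ring] at h1

lemma IsGrading.mk_smul_mem (hgr : IsGrading (k := k) gr) {i j : ℤ} {s : PolyRing k} {m : M}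
    (hs : s ∈ polyDeg k i) (hm : m ∈ gr j) : π s • m ∈ gr (i + j) :=
  hgr.smul_mem _ _ _ _ (mk_mem_ringDeg hs) hm

/-- With both generators in one degree, scalar row operations are homogeneous; they normalize the
linear column. A column operation then corrects the quadratic one. -/
lemma IsPres.gradedIso_phi (hgr : IsGrading (k := k) gr) {g₁ g₂ : M} {a : ℤ}
    {l₁ l₂ q₁ q₂ : PolyRing k} (h : IsPres gr g₁ g₂ a a l₁ q₁ l₂ q₂) (h₁ : l₁ ∈ polyDeg k 1)
    (h₂ : l₂ ∈ polyDeg k 1) (hq₁ : q₁ ∈ polyDeg k 2) (hq₂ : q₂ ∈ polyDeg k 2) {c : k} (hc : c ≠ 0)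
    (hdet : l₁ * q₂ - q₁ * l₂ = C c * cubic k) :
    ∃ p ∈ curve k, ∃ d, GradedIso k gr (cokerPhiDeg p) d := by
  obtain ⟨p, hp, e, f, g, h', hne, hl, hl'⟩ := exists_point hc h₁ h₂
    (constantCoeff_of_mem (by norm_num) hq₁) (constantCoeff_of_mem (by norm_num) hq₂) hdet
  have hD : C (e * h' - f * g)⁻¹ * (C e * C h' - C f * C g) = (1 : PolyRing k) := by
    rw [← C_mul, ← C_mul, ← C_sub, ← C_mul, inv_mul_cancel₀ hne, C_1]
  have hmem : ∀ x y : k, ∀ {z z' : PolyRing k}, z = C x → z' = C y → π z • g₁ + π z' • g₂ ∈ gr a := by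
    rintro x y _ _ rfl rfl
    have e₁ := hgr.mk_smul_mem (C_mem x) h.left_mem
    have e₂ := hgr.mk_smul_mem (C_mem y) h.right_mem
    rw [zero_add] at e₁ e₂
    exact add_mem e₁ e₂
  have h3 := h.change_generators (C (e * h' - f * g)⁻¹) (C e) (C f) (C g) (C h') hD (b₁ := a) (b₂ := a)
    (hmem ((e * h' - f * g)⁻¹ * h') (-((e * h' - f * g)⁻¹ * g)) (by simp) (by simp))
    (hmem (-((e * h' - f * g)⁻¹ * f)) ((e * h' - f * g)⁻¹ * e) (by simp) (by simp))
  rw [hl, hl'] at h3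
  have hdet' : phi p 0 0 * (C g * q₁ + C h' * q₂) - (C e * q₁ + C f * q₂) * phi p 1 0 =
      C ((e * h' - f * g) * c) * cubic k := by
    rw [C_mul, mul_assoc, ← hdet, ← hl, ← hl', C_sub, C_mul, C_mul]
    ring
  obtain ⟨t, -, ht₁, ht₂⟩ := exists_of_det_eq (phi_mem hp 0 0) (phi_mem hp 1 0) (phi_mem hp 0 1)
    (phi_mem hp 1 1) (add_mem (C_mul_mem e hq₁) (C_mul_mem f hq₂))
    (add_mem (C_mul_mem g hq₁) (C_mul_mem h' hq₂))
    (by rw [← Matrix.det_fin_two, det_phi hp]) hdet'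
  set D := (e * h' - f * g) * c with hDdef
  have hDne : D ≠ 0 := mul_ne_zero hne hc
  have hDD : (C D * C D⁻¹ : PolyRing k) = 1 := by rw [← C_mul, mul_inv_cancel₀ hDne, C_1]
  have h4 := h3.change_relations (C D) 1 0 (-(t * C D⁻¹)) (C D⁻¹) (by linear_combination hDD)
  rw [ht₁, ht₂, show 1 * phi p 0 0 + 0 * (C D * phi p 0 1 + t * phi p 0 0) = phi p 0 0 by ring,
    show 1 * phi p 1 0 + 0 * (C D * phi p 1 1 + t * phi p 1 0) = phi p 1 0 by ring,
    show -(t * C D⁻¹) * phi p 0 0 + C D⁻¹ * (C D * phi p 0 1 + t * phi p 0 0) = phi p 0 1 by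
      linear_combination phi p 0 1 * hDD,
    show -(t * C D⁻¹) * phi p 1 0 + C D⁻¹ * (C D * phi p 1 1 + t * phi p 1 0) = phi p 1 1 by
      linear_combination phi p 1 1 * hDD] at h4
  exact ⟨p, hp, _, h4.gradedIso hgr ![1, 1] (a - 1) (by simp) (by simp)⟩

/-- The transposed situation: scalar column operations normalize the linear row. The quadratic row
is corrected by a linear multiple of it, homogeneous because the generator degrees differ by one. -/
lemma IsPres.gradedIso_psi (hgr : IsGrading (k := k) gr) {g₁ g₂ : M} {a : ℤ}
    {l₁ l₂ q₁ q₂ : PolyRing k} (h : IsPres gr g₁ g₂ a (a + 1) q₁ q₂ l₁ l₂) (h₁ : l₁ ∈ polyDeg k 1)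
    (h₂ : l₂ ∈ polyDeg k 1) (hq₁ : q₁ ∈ polyDeg k 2) (hq₂ : q₂ ∈ polyDeg k 2) {c : k} (hc : c ≠ 0)
    (hdet : q₁ * l₂ - q₂ * l₁ = C c * cubic k) :
    ∃ p ∈ curve k, ∃ d, GradedIso k gr (cokerPsiDeg p) d := by
  obtain ⟨p, hp, e, f, g, h', hne, hl, hl'⟩ := exists_point hc h₂ h₁
    (constantCoeff_of_mem (by norm_num) hq₂) (constantCoeff_of_mem (by norm_num) hq₁)
    (by rw [← hdet]; ring)
  have hD : C (-(e * h' - f * g)⁻¹) * (-C h' * C e - -C g * C f) = (1 : PolyRing k) := by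
    have : (C (e * h' - f * g)⁻¹ * (C e * C h' - C f * C g) : PolyRing k) = 1 := by
      rw [← C_mul, ← C_mul, ← C_sub, ← C_mul, inv_mul_cancel₀ hne, C_1]
    rw [C_neg]
    linear_combination this
  -- The target bottom row is `(-φ₁₀, φ₀₀)`: hence the swapped order of `l₁`, `l₂` above and the
  -- sign of the determinant.
  have h3 := h.change_relations _ (-C h') (-C g) (C f) (C e) hD
  rw [show -C h' * l₁ + -C g * l₂ = -phi p 1 0 by rw [← hl']; ring,
    show C f * l₁ + C e * l₂ = phi p 0 0 by rw [← hl]; ring] at h3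
  have hdet' : phi p 0 0 * (-C h' * q₁ + -C g * q₂) - (-(C f * q₁ + C e * q₂)) * phi p 1 0 =
      C (-((e * h' - f * g) * c)) * cubic k := by
    rw [C_neg, C_mul, ← hl, ← hl', C_sub, C_mul, C_mul]
    linear_combination -(C e * C h' - C f * C g) * hdet
  obtain ⟨t, ht, ht₁, ht₂⟩ := exists_of_det_eq (phi_mem hp 0 0) (phi_mem hp 1 0) (phi_mem hp 0 1)
    (phi_mem hp 1 1) (neg_mem (add_mem (C_mul_mem f hq₁) (C_mul_mem e hq₂)))
    (by
      rw [← C_neg, ← C_neg]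
      exact add_mem (C_mul_mem _ hq₁) (C_mul_mem _ hq₂))
    (by rw [← Matrix.det_fin_two, det_phi hp]) hdet'
  set D := -((e * h' - f * g) * c) with hDdef
  have hDne : D ≠ 0 := neg_ne_zero.2 (mul_ne_zero hne hc)
  have hDD : (C D * C D⁻¹ : PolyRing k) = 1 := by rw [← C_mul, mul_inv_cancel₀ hDne, C_1]
  have m₁ : π (C D * 1) • g₁ + π (-(C D * 0)) • g₂ ∈ gr a := by
    have := hgr.mk_smul_mem (C_mem D) h.left_mem
    rw [mk_smul_eq_zero (s := -(C D * 0)) (by simp), add_zero, mul_one]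
    rwa [zero_add] at this
  have m₂ : π (-(C D * (t * C D⁻¹))) • g₁ + π (C D * C D⁻¹) • g₂ ∈ gr (a + 1) := by
    have e₁ := hgr.mk_smul_mem (neg_mem ht) h.left_mem
    have e₂ := hgr.mk_smul_mem (C_mem 1) h.right_mem
    rw [hDD, show -(C D * (t * C D⁻¹)) = -t by linear_combination -t * hDD]
    rw [zero_add] at e₂
    rw [add_comm 1] at e₁
    exact add_mem e₁ e₂
  have h4 := h3.change_generators (C D) (C D⁻¹) (t * C D⁻¹) 0 1 (by linear_combination hDD) m₁ m₂
  rw [show C f * q₁ + C e * q₂ = -(C D * phi p 0 1 + t * phi p 0 0) by rw [← ht₁, neg_neg], ht₂,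
    show C D⁻¹ * (C D * phi p 1 1 + t * phi p 1 0) + t * C D⁻¹ * (-phi p 1 0) = psi p 0 0 by
      rw [psi_eq_adjugate, Matrix.adjugate_fin_two]
      change _ = phi p 1 1
      linear_combination phi p 1 1 * hDD,
    show C D⁻¹ * -(C D * phi p 0 1 + t * phi p 0 0) + t * C D⁻¹ * phi p 0 0 = psi p 0 1 by
      rw [psi_eq_adjugate, Matrix.adjugate_fin_two]
      change _ = -phi p 0 1
      linear_combination -phi p 0 1 * hDD,
    show 0 * (C D * phi p 1 1 + t * phi p 1 0) + 1 * (-phi p 1 0) = psi p 1 0 by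
      rw [psi_eq_adjugate, Matrix.adjugate_fin_two]
      change _ = -phi p 1 0
      ring,
    show 0 * -(C D * phi p 0 1 + t * phi p 0 0) + 1 * phi p 0 0 = psi p 1 1 by
      rw [psi_eq_adjugate, Matrix.adjugate_fin_two]
      change _ = phi p 0 0
      ring] at h4
  exact ⟨p, hp, _, h4.gradedIso hgr ![0, 1] a (by simp) (by simp [add_comm])⟩

/-- Two-generated non-free graded MCM modules are cokernels of the given matrices. -/
theorem classification (h : IsGradedMCM (k := k) gr)
    (h2 : (⊤ : Submodule (NodeRing k) M).spanFinrank = 2) (hfree : ¬ Module.Free (NodeRing k) M) :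
    (∃ p ∈ curve k, ∃ d, GradedIso k gr (cokerPhiDeg p) d) ∨
      ∃ p ∈ curve k, ∃ d, GradedIso k gr (cokerPsiDeg p) d := by
  obtain ⟨g₁, g₂, a₁, a₂, b₁, b₂, p, q, r, s, hpres, hp, hq, hr, hs, cp, cq, cr, cs, c, hc, hdet⟩ :=
    exists_isPres h h2 hfree
  have hc' : -c ≠ 0 := neg_ne_zero.2 hc
  have np : p ≠ 0 := by
    rintro rfl
    exact cubic_no_factor hc (x := -q) (y := r) (by rw [← hdet]; ring) (by simp [cq]) cr
  have ns : s ≠ 0 := by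
    rintro rfl
    exact cubic_no_factor hc (x := -q) (y := r) (by rw [← hdet]; ring) (by simp [cq]) cr
  have nq : q ≠ 0 := by
    rintro rfl
    exact cubic_no_factor hc (x := p) (y := s) (by rw [← hdet]; ring) cp cs
  have nr : r ≠ 0 := by
    rintro rfl
    exact cubic_no_factor hc (x := p) (y := s) (by rw [← hdet]; ring) cp cs
  have dp := degree_pos_of_mem hp np cp
  have dq := degree_pos_of_mem hq nq cq
  have dr := degree_pos_of_mem hr nr cr
  have ds := degree_pos_of_mem hs ns cs
  have hsum : b₁ - a₁ + (b₂ - a₂) = 3 := by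
    have e₁ := polyDeg_mul hp hs
    have e₂ := polyDeg_mul hq hr
    rw [show b₂ - a₁ + (b₁ - a₂) = b₁ - a₁ + (b₂ - a₂) by ring] at e₂
    have e₃ := sub_mem e₁ e₂
    rw [hdet] at e₃
    exact degree_eq_of_mem e₃ (C_mul_mem c cubic_mem)
      (mul_ne_zero (by simpa using hc) (cubic_ne_zero k))
  -- The four entry degrees are positive, and each diagonal has total degree 3.
  have hcases : (b₁ = a₁ + 1 ∧ b₂ = a₁ + 2 ∧ a₂ = a₁) ∨ (b₁ = a₁ + 2 ∧ b₂ = a₁ + 1 ∧ a₂ = a₁) ∨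
      (b₁ = a₁ + 2 ∧ b₂ = a₁ + 2 ∧ a₂ = a₁ + 1) ∨
      (b₁ = a₂ + 2 ∧ b₂ = a₂ + 2 ∧ a₁ = a₂ + 1) := by omega
  rcases hcases with ⟨rfl, rfl, rfl⟩ | ⟨rfl, rfl, rfl⟩ | ⟨rfl, rfl, rfl⟩ | ⟨rfl, rfl, rfl⟩ <;>
    ring_nf at hp hq hr hs
  · exact Or.inl (hpres.gradedIso_phi h.isGrading hp hr hq hs hc hdet)
  · exact Or.inl (hpres.swap_relations.gradedIso_phi h.isGrading hq hs hp hr hc'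
      (by rw [C_neg]; linear_combination -hdet))
  · exact Or.inr (hpres.gradedIso_psi h.isGrading hr hs hp hq hc hdet)
  · exact Or.inr (hpres.swap_generators.gradedIso_psi h.isGrading hp hq hr hs hc'
      (by rw [C_neg]; linear_combination -hdet))

end Classification

/-! ### Periodicity and ranks. -/

section Cokernels

variable {k : Type u} [Field k]

local notation "π" => Ideal.Quotient.mk (Ideal.span {cubic k})

lemma psi_apply (p : ℙ k (Fin 3 → k)) :
    psi p 0 0 = phi p 1 1 ∧ psi p 0 1 = -phi p 0 1 ∧ psi p 1 0 = -phi p 1 0 ∧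
      psi p 1 1 = phi p 0 0 := by
  rw [psi_eq_adjugate, Matrix.adjugate_fin_two]
  exact ⟨rfl, rfl, rfl, rfl⟩

lemma isGradedMatrixFactorization {p : ℙ k (Fin 3 → k)} (hp : p ∈ curve k) :
    IsGradedMatrixFactorization (cubic k) 3 ![1, 1] ![2, 3] (phi p) (psi p) where
  mul_eq := by rw [psi_eq_adjugate, Matrix.mul_adjugate, det_phi hp]
  mul_eq' := by rw [psi_eq_adjugate, Matrix.adjugate_mul, det_phi hp]
  left_mem i j := by
    convert! phi_mem hp i j using 2
    fin_cases i <;> fin_cases j <;> rfl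
  right_mem i j := by
    obtain ⟨h00, h01, h10, h11⟩ := psi_apply p
    fin_cases i <;> fin_cases j
    · exact h00 ▸ phi_mem hp 1 1
    · exact h01 ▸ neg_mem (phi_mem hp 0 1)
    · exact h10 ▸ neg_mem (phi_mem hp 1 0)
    · exact h11 ▸ phi_mem hp 0 0

/-- If `A w = f x` over `S`, then `f w = B A w = f B x`, and `f` cancels. -/
lemma ker_matMap {n : ℕ} {A B : Matrix (Fin n) (Fin n) (PolyRing k)}
    (hAB : A * B = cubic k • (1 : Matrix (Fin n) (Fin n) (PolyRing k)))
    (hBA : B * A = cubic k • (1 : Matrix (Fin n) (Fin n) (PolyRing k))) :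
    LinearMap.ker (matMap A) = LinearMap.range (matMap B) := by
  ext v
  constructor
  · intro hv
    obtain ⟨w, rfl⟩ := exists_lift v
    rw [LinearMap.mem_ker, matMap_mk] at hv
    choose x hx using fun i => mk_eq_zero_iff.1 (congrFun hv i)
    have h1 : cubic k • w = cubic k • B.mulVec x := by
      have hx' : A.mulVec w = cubic k • x := funext hx
      rw [← Matrix.mulVec_smul, ← hx', Matrix.mulVec_mulVec, hBA, Matrix.smul_mulVec,
        Matrix.one_mulVec]
    have h2 : w = B.mulVec x := by
      ext1 i
      exact mul_left_cancel₀ (cubic_ne_zero k) (congrFun h1 i)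
    exact ⟨fun i => π (x i), by rw [matMap_mk, ← h2]⟩
  · rintro ⟨x, rfl⟩
    obtain ⟨y, rfl⟩ := exists_lift x
    rw [LinearMap.mem_ker, matMap_mk, matMap_mk, Matrix.mulVec_mulVec, hAB, Matrix.smul_mulVec,
      Matrix.one_mulVec]
    ext1 i
    exact mk_eq_zero_iff.2 ⟨y i, rfl⟩

lemma ker_phi {p : ℙ k (Fin 3 → k)} (hp : p ∈ curve k) :
    LinearMap.ker (matMap (phi p)) = LinearMap.range (matMap (psi p)) :=
  ker_matMap (isGradedMatrixFactorization hp).mul_eq (isGradedMatrixFactorization hp).mul_eq'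

lemma ker_psi {p : ℙ k (Fin 3 → k)} (hp : p ∈ curve k) :
    LinearMap.ker (matMap (psi p)) = LinearMap.range (matMap (phi p)) :=
  ker_matMap (isGradedMatrixFactorization hp).mul_eq' (isGradedMatrixFactorization hp).mul_eq

/-- The values of the linear entries of `φ_p` can be prescribed. -/
lemma exists_eval_phi {p : ℙ k (Fin 3 → k)} (hp : p ∈ curve k) (x y : k) :
    ∃ c, eval c (phi p 0 0) = x ∧ eval c (phi p 1 0) = y := by
  rcases eq_infPt_or_affPt hp with rfl | ⟨a, b, hab, rfl⟩
  · exact ⟨![x - y, 0, y], by simp [phi_infPt, phiInf], by simp [phi_infPt, phiInf]⟩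
  · exact ⟨![x, y, 0], by simp [phi_affPt, phiAff], by simp [phi_affPt, phiAff]⟩

lemma phi_ne_zero {p : ℙ k (Fin 3 → k)} (hp : p ∈ curve k) : ¬ cubic k ∣ phi p 0 0 := by
  rintro ⟨t, ht⟩
  have h1 := hc_self (phi_mem hp 0 0)
  rw [ht, mul_comm, hc_mul cubic_mem, hc_of_neg (by simp)] at h1
  obtain ⟨c, hc, -⟩ := exists_eval_phi hp 1 0
  rw [ht, mul_comm, ← h1] at hc
  simp at hc

lemma range_ne_bot {n : ℕ} {A : Matrix (Fin n) (Fin n) (PolyRing k)} {i j : Fin n}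
    (h : ¬ cubic k ∣ A i j) : LinearMap.range (matMap A) ≠ ⊥ := by
  intro h0
  apply h
  rw [← mk_eq_zero_iff]
  have h1 : matMap A (fun l => π ((Pi.single j 1 : Fin n → PolyRing k) l)) = 0 := by
    rw [LinearMap.range_eq_bot.1 h0]; rfl
  rw [matMap_mk] at h1
  have h2 := congrFun h1 i
  rwa [Matrix.mulVec_single_one] at h2

/-- `Coker A` is isomorphic to the image of `B`. The ranks of the images of `A` and `B` are positive
and add up to two. -/
lemma rank_coker {A B : Matrix (Fin 2) (Fin 2) (PolyRing k)}
    (h : LinearMap.ker (matMap B) = LinearMap.range (matMap A))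
    (hA : LinearMap.range (matMap A) ≠ ⊥) (hB : LinearMap.range (matMap B) ≠ ⊥) :
    Module.rank (NodeRing k) (Coker A) = 1 := by
  have e : Coker A ≃ₗ[NodeRing k] LinearMap.range (matMap B) :=
    (Submodule.quotEquivOfEq _ _ h.symm).trans (matMap B).quotKerEquivRange
  have h1 := Submodule.finrank_quotient_add_finrank (LinearMap.range (matMap A))
  have h2 := e.finrank_eq
  have h3 : 0 < Module.finrank (NodeRing k) (LinearMap.range (matMap A)) := by
    have := Submodule.nontrivial_iff_ne_bot.2 hA
    exact Module.finrank_pos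
  have h4 : 0 < Module.finrank (NodeRing k) (LinearMap.range (matMap B)) := by
    have := Submodule.nontrivial_iff_ne_bot.2 hB
    exact Module.finrank_pos
  rw [Module.finrank_fintype_fun_eq_card, Fintype.card_fin] at h1
  rw [← Module.finrank_eq_rank]
  have h5 : Module.finrank (NodeRing k) (Coker A) = 1 := by
    change Module.finrank (NodeRing k) (Coker A) + _ = _ at h1
    omega
  exact_mod_cast h5

lemma rank_coker_phi_psi {p : ℙ k (Fin 3 → k)} (hp : p ∈ curve k) :
    Module.rank (NodeRing k) (Coker (phi p)) = 1 ∧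
      Module.rank (NodeRing k) (Coker (psi p)) = 1 := by
  have h1 : LinearMap.range (matMap (phi p)) ≠ ⊥ := range_ne_bot (phi_ne_zero hp)
  have h2 : LinearMap.range (matMap (psi p)) ≠ ⊥ :=
    range_ne_bot (i := 1) (j := 1) (by rw [(psi_apply p).2.2.2]; exact phi_ne_zero hp)
  exact ⟨rank_coker (ker_psi hp) h1 h2, rank_coker (ker_phi hp) h2 h1⟩

end Cokernels

/-! ### The first syzygy and the dual, with gradings. -/

section GradedMaps

variable {k : Type u} [Field k]

local notation "π" => Ideal.Quotient.mk (Ideal.span {cubic k})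

lemma mem_freeDeg {n : ℕ} {a : Fin n → ℤ} {j : ℤ} {v : Fin n → NodeRing k} :
    v ∈ freeDeg k a j ↔ ∀ i, v i ∈ ringDeg k (j - a i) := by
  simp [freeDeg, AddSubgroup.mem_pi]

lemma ringDeg_mul {d e : ℤ} {r s : NodeRing k} (hr : r ∈ ringDeg k d) (hs : s ∈ ringDeg k e) :
    r * s ∈ ringDeg k (d + e) := by
  obtain ⟨x, hx, rfl⟩ := hr
  obtain ⟨y, hy, rfl⟩ := hs
  exact ⟨x * y, polyDeg_mul hx hy, map_mul π x y⟩

lemma matMap_apply {n : ℕ} (A : Matrix (Fin n) (Fin n) (PolyRing k)) (u : Fin n → NodeRing k)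
    (i : Fin n) : matMap A u i = ∑ l, π (A i l) * u l := rfl

/-- A homogeneous matrix maps homogeneous vectors to homogeneous vectors. -/
lemma matMap_mem {n : ℕ} {A : Matrix (Fin n) (Fin n) (PolyRing k)} {a b : Fin n → ℤ}
    (hA : ∀ i l, A i l ∈ polyDeg k (b l - a i)) {j : ℤ} {u : Fin n → NodeRing k}
    (hu : u ∈ freeDeg k b j) : matMap A u ∈ freeDeg k a j := by
  rw [mem_freeDeg] at hu ⊢
  intro i
  rw [matMap_apply]
  refine sum_mem fun l _ => ?_
  have := ringDeg_mul (mk_mem_ringDeg (hA i l)) (hu l)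
  rwa [show b l - a i + (j - b l) = j - a i by ring] at this

/-- A homogeneous vector in the image of a homogeneous matrix is the image of a homogeneous
vector. -/
lemma exists_homogeneous_preimage {n : ℕ} {A : Matrix (Fin n) (Fin n) (PolyRing k)}
    {a b : Fin n → ℤ} (hA : ∀ i l, A i l ∈ polyDeg k (b l - a i)) {j : ℤ} {u : Fin n → NodeRing k}
    (hu : matMap A u ∈ freeDeg k a j) : ∃ u' ∈ freeDeg k b j, matMap A u' = matMap A u := by
  obtain ⟨x, rfl⟩ := exists_lift u
  rw [mem_freeDeg] at hu
  refine ⟨fun l => π (hc (j - b l) (x l)), mem_freeDeg.2 fun l => mk_mem_ringDeg (hc_mem _ _), ?_⟩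
  rw [matMap_mk] at hu ⊢
  rw [matMap_mk]
  ext1 i
  obtain ⟨s, hs, hsi⟩ := hu i
  obtain ⟨t, ht⟩ : cubic k ∣ A.mulVec x i - s := by
    rw [← mk_eq_zero_iff, map_sub, sub_eq_zero]
    exact hsi.symm
  refine Eq.trans ?_ hsi
  change _ = π s
  rw [← sub_eq_zero, ← map_sub, mk_eq_zero_iff]
  -- Taking components preserves congruence modulo the homogeneous form `f`.
  have h1 := congrArg (hc (j - a i)) ht
  rw [map_sub, hc_self hs, mul_comm (cubic k), hc_mul cubic_mem] at h1
  refine ⟨hc (j - a i - 3) t, ?_⟩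
  rw [mul_comm (cubic k), ← h1]
  congr 1
  simp only [Matrix.mulVec, dotProduct, map_sum]
  refine Finset.sum_congr rfl fun l _ => ?_
  rw [mul_comm (A i l) (x l), hc_mul (hA i l), mul_comm,
    show j - a i - (b l - a i) = j - b l by ring]

/-- The source carries the degrees `(0, 1)` of the generators of `Coker ψ_p`. The target degrees are
then `-1` instead of `1`, which is the shift by two. -/
lemma phi_mem' {p : ℙ k (Fin 3 → k)} (hp : p ∈ curve k) (i l : Fin 2) :
    phi p i l ∈ polyDeg k ((![0, 1] : Fin 2 → ℤ) l - (fun _ => -1 : Fin 2 → ℤ) i) := by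
  convert! phi_mem hp i l using 2
  fin_cases l <;> rfl

lemma mem_freeDeg_one {j : ℤ} {v : Fin 2 → NodeRing k} :
    v ∈ freeDeg k ![1, 1] j ↔ ∀ i, v i ∈ ringDeg k (j - 1) := by
  rw [mem_freeDeg]
  simp [Fin.forall_fin_two]

lemma phi_homogeneous {p : ℙ k (Fin 3 → k)} (hp : p ∈ curve k) {j : ℤ} {u : Fin 2 → NodeRing k}
    (hu : u ∈ freeDeg k ![0, 1] j) (i : Fin 2) : matMap (phi p) u i ∈ ringDeg k (j + 1) := by
  simpa using mem_freeDeg.1 (matMap_mem (phi_mem' hp) hu) i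

lemma phi_exists_homogeneous {p : ℙ k (Fin 3 → k)} (hp : p ∈ curve k) {j : ℤ}
    {u : Fin 2 → NodeRing k} (hu : ∀ i, matMap (phi p) u i ∈ ringDeg k (j + 1)) :
    ∃ u' ∈ freeDeg k ![0, 1] j, matMap (phi p) u' = matMap (phi p) u :=
  exists_homogeneous_preimage (phi_mem' hp) (mem_freeDeg.2 fun i => by simpa using hu i)

lemma mk_mem_irrelevant {s : PolyRing k} (h : constantCoeff s = 0) : π s ∈ irrelevant k := by
  obtain ⟨s₀, s₁, s₂, rfl⟩ := exists_of_constantCoeff_eq_zero h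
  simp only [map_add, map_mul]
  have hX : ∀ i, π (X i) ∈ irrelevant k := fun i => Ideal.subset_span ⟨i, rfl⟩
  exact add_mem (add_mem (Ideal.mul_mem_right _ _ (hX 0)) (Ideal.mul_mem_right _ _ (hX 1)))
    (Ideal.mul_mem_right _ _ (hX 2))

lemma constantCoeff_phi {p : ℙ k (Fin 3 → k)} (hp : p ∈ curve k) (i l : Fin 2) :
    constantCoeff (phi p i l) = 0 :=
  constantCoeff_of_mem (by fin_cases l <;> simp) (phi_mem hp i l)

lemma mem_smul_top_of_forall {A : Type v} [CommRing A] {I : Ideal A} {n : ℕ} {v : Fin n → A}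
    (h : ∀ i, v i ∈ I) : v ∈ I • (⊤ : Submodule A (Fin n → A)) := by
  have h1 : v = ∑ i, v i • (Pi.single i 1 : Fin n → A) := by
    conv_lhs => rw [← Finset.univ_sum_single v]
    refine Finset.sum_congr rfl fun i _ => ?_
    rw [← Pi.single_smul, smul_eq_mul, mul_one]
  rw [h1]
  exact Submodule.sum_mem _ fun i _ => Submodule.smul_mem_smul (h i) trivial

lemma coker_dual_ext {n : ℕ} {A : Matrix (Fin n) (Fin n) (PolyRing k)}
    {g g' : Module.Dual (NodeRing k) (Coker A)}
    (h : ∀ v, g (Submodule.mkQ _ v) = g' (Submodule.mkQ _ v)) : g = g' :=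
  LinearMap.ext fun x => by
    obtain ⟨v, rfl⟩ := Submodule.mkQ_surjective _ x
    exact h v

/-- `Coker ψ_p` is the first syzygy of `Coker φ_p`. -/
theorem isFirstSyzygy {p : ℙ k (Fin 3 → k)} (hp : p ∈ curve k) :
    IsFirstSyzygy k (cokerPsiDeg p) (cokerPhiDeg p) 2 := by
  refine ⟨2, ![1, 1], (LinearMap.range (matMap (phi p))).mkQ, Submodule.mkQ_surjective _,
    fun j x hx => ⟨x, hx, rfl⟩, ?_, ?_⟩
  · rw [Submodule.ker_mkQ]
    rintro _ ⟨u, rfl⟩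
    refine mem_smul_top_of_forall fun i => ?_
    rw [matMap_apply]
    exact Ideal.sum_mem _ fun l _ =>
      Ideal.mul_mem_right _ _ (mk_mem_irrelevant (constantCoeff_phi hp i l))
  -- The kernel of the cover is `im φ`, which is `R² / ker φ = R² / im ψ`.
  · let e : Coker (psi p) ≃ₗ[NodeRing k]
        LinearMap.ker (LinearMap.range (matMap (phi p))).mkQ :=
      ((Submodule.quotEquivOfEq _ _ (ker_phi hp).symm).trans
        (matMap (phi p)).quotKerEquivRange).trans (LinearEquiv.ofEq _ _ (Submodule.ker_mkQ _).symm)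
    have he : ∀ u, (e (Submodule.mkQ _ u) : Fin 2 → NodeRing k) = matMap (phi p) u := fun u => rfl
    refine ⟨e, fun j => ?_⟩
    ext x
    constructor
    · rintro ⟨_, ⟨u, hu, rfl⟩, rfl⟩
      change (e (Submodule.mkQ _ u) : Fin 2 → NodeRing k) ∈ freeDeg k ![1, 1] (j + 2)
      rw [he, mem_freeDeg_one, show j + 2 - 1 = j + 1 by ring]
      exact phi_homogeneous hp hu
    · intro hx
      change (x : Fin 2 → NodeRing k) ∈ freeDeg k ![1, 1] (j + 2) at hx
      obtain ⟨y, rfl⟩ := e.surjective x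
      obtain ⟨u, rfl⟩ := Submodule.mkQ_surjective _ y
      rw [he, mem_freeDeg_one, show j + 2 - 1 = j + 1 by ring] at hx
      obtain ⟨u', hu', h⟩ := phi_exists_homogeneous hp hx
      refine ⟨Submodule.mkQ _ u', ⟨u', hu', rfl⟩, Subtype.ext ?_⟩
      change (e (Submodule.mkQ _ u') : Fin 2 → NodeRing k) = _
      rw [he, he, h]

variable (k) in
/-- The determinant pairing on `R²`. -/
def detPairing : (Fin 2 → NodeRing k) →ₗ[NodeRing k] (Fin 2 → NodeRing k) →ₗ[NodeRing k] NodeRing k :=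
  LinearMap.mk₂ (NodeRing k) (fun x v => v 0 * x 1 - v 1 * x 0)
    (fun x y v => by simp only [Pi.add_apply]; ring)
    (fun c x v => by simp only [Pi.smul_apply, smul_eq_mul]; ring)
    (fun x v w => by simp only [Pi.add_apply]; ring)
    (fun c x v => by simp only [Pi.smul_apply, smul_eq_mul]; ring)

lemma detPairing_apply (x v : Fin 2 → NodeRing k) :
    detPairing k x v = v 0 * x 1 - v 1 * x 0 := rfl

lemma det_phi_mk {p : ℙ k (Fin 3 → k)} (hp : p ∈ curve k) :
    π (phi p 0 0) * π (phi p 1 1) - π (phi p 0 1) * π (phi p 1 0) = 0 := by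
  rw [← map_mul, ← map_mul, ← map_sub, ← Matrix.det_fin_two, det_phi hp]
  exact mk_eq_zero_iff.2 dvd_rfl

/-- The linear form on `Coker φ_p` given by the pairing with `φ_p u`. -/
def dualMap {p : ℙ k (Fin 3 → k)} (hp : p ∈ curve k) :
    (Fin 2 → NodeRing k) →ₗ[NodeRing k] Module.Dual (NodeRing k) (Coker (phi p)) where
  toFun u := (LinearMap.range (matMap (phi p))).liftQ (detPairing k (matMap (phi p) u)) (by
    rintro _ ⟨w, rfl⟩
    rw [LinearMap.mem_ker, detPairing_apply]
    simp only [matMap_apply, Fin.sum_univ_two]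
    -- The pairing of `φ w` with `φ u` is `det φ` times that of `w` with `u`, and `det φ = f`
    -- vanishes in `R`.
    linear_combination (w 0 * u 1 - w 1 * u 0) * det_phi_mk hp)
  map_add' u w := coker_dual_ext fun v => by
    simp only [map_add, LinearMap.add_apply, Submodule.mkQ_apply, Submodule.liftQ_apply]
  map_smul' c u := coker_dual_ext fun v => by
    simp only [map_smul, LinearMap.smul_apply, Submodule.mkQ_apply, Submodule.liftQ_apply,
      RingHom.id_apply]

lemma dualMap_mk {p : ℙ k (Fin 3 → k)} (hp : p ∈ curve k) (u v : Fin 2 → NodeRing k) :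
    dualMap hp u (Submodule.mkQ _ v) = v 0 * matMap (phi p) u 1 - v 1 * matMap (phi p) u 0 := rfl

lemma dualMap_congr {p : ℙ k (Fin 3 → k)} (hp : p ∈ curve k) {u u' : Fin 2 → NodeRing k}
    (h : matMap (phi p) u = matMap (phi p) u') : dualMap hp u = dualMap hp u' := by
  refine coker_dual_ext fun v => ?_
  rw [dualMap_mk, dualMap_mk, h]

lemma dualMap_basis {p : ℙ k (Fin 3 → k)} (hp : p ∈ curve k) (u : Fin 2 → NodeRing k) :
    dualMap hp u (Submodule.mkQ _ ![1, 0]) = matMap (phi p) u 1 ∧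
      dualMap hp u (Submodule.mkQ _ ![0, 1]) = -matMap (phi p) u 0 := by
  rw [dualMap_mk, dualMap_mk]
  simp

lemma ker_dualMap {p : ℙ k (Fin 3 → k)} (hp : p ∈ curve k) :
    LinearMap.ker (dualMap hp) = LinearMap.range (matMap (psi p)) := by
  rw [← ker_phi hp]
  ext u
  rw [LinearMap.mem_ker, LinearMap.mem_ker]
  constructor
  · intro h
    obtain ⟨h1, h0⟩ := dualMap_basis hp u
    rw [h] at h1 h0
    ext1 i
    fin_cases i
    · exact neg_eq_zero.1 h0.symm
    · exact h1.symm
  · intro h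
    rw [dualMap_congr hp (u' := 0) (by rw [h, map_zero]), map_zero]

/-- A form on `R²` with values `x`, `y` on the basis is the pairing with `(-y, x)`. It kills `im φ`
exactly when `ψ` kills this vector, which then lies in `ker ψ = im φ`. -/
lemma dualMap_surjective {p : ℙ k (Fin 3 → k)} (hp : p ∈ curve k) :
    Function.Surjective (dualMap hp) := by
  intro g
  let g' := g.comp (Submodule.mkQ (LinearMap.range (matMap (phi p))))
  have hg' : ∀ v, g' v = v 0 * g' ![1, 0] + v 1 * g' ![0, 1] := by
    intro v
    conv_lhs => rw [show v = v 0 • ![1, 0] + v 1 • ![0, 1] by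
      ext1 i; fin_cases i <;> simp]
    rw [map_add, map_smul, map_smul, smul_eq_mul, smul_eq_mul]
  have hker : ∀ u, g' (matMap (phi p) u) = 0 := by
    intro u
    change g (Submodule.mkQ _ _) = 0
    rw [Submodule.mkQ_apply, (Submodule.Quotient.mk_eq_zero _).2
      (LinearMap.mem_range_self _ u), map_zero]
  have h0 := hker ![1, 0]
  have h1 := hker ![0, 1]
  rw [hg'] at h0 h1
  simp only [matMap_apply, Fin.sum_univ_two, Matrix.cons_val_zero, Matrix.cons_val_one, mul_one,
    mul_zero, add_zero, zero_add] at h0 h1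
  have hx : ![-g' ![0, 1], g' ![1, 0]] ∈ LinearMap.range (matMap (phi p)) := by
    rw [← ker_psi hp, LinearMap.mem_ker]
    obtain ⟨e00, e01, e10, e11⟩ := psi_apply p
    ext1 i
    fin_cases i
    · change matMap (psi p) _ 0 = 0
      rw [matMap_apply, Fin.sum_univ_two, e00, e01, map_neg]
      simp only [Matrix.cons_val_zero, Matrix.cons_val_one]
      linear_combination -h1
    · change matMap (psi p) _ 1 = 0
      rw [matMap_apply, Fin.sum_univ_two, e10, e11, map_neg]
      simp only [Matrix.cons_val_zero, Matrix.cons_val_one]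
      linear_combination h0
  obtain ⟨u, hu⟩ := hx
  refine ⟨u, ?_⟩
  refine coker_dual_ext fun v => ?_
  change dualMap hp u (Submodule.mkQ _ v) = g' v
  rw [dualMap_mk, hu, hg' v]
  simp only [Matrix.cons_val_zero, Matrix.cons_val_one]
  ring

/-- `Coker ψ_p` is the dual of `Coker φ_p`. -/
theorem gradedIso_dual {p : ℙ k (Fin 3 → k)} (hp : p ∈ curve k) :
    GradedIso k (cokerPsiDeg p) (dualDeg k (cokerPhiDeg p)) 0 := by
  let e : Coker (psi p) ≃ₗ[NodeRing k] Module.Dual (NodeRing k) (Coker (phi p)) :=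
    (Submodule.quotEquivOfEq _ _ (ker_dualMap hp).symm).trans
      ((dualMap hp).quotKerEquivOfSurjective (dualMap_surjective hp))
  have he : ∀ u, e (Submodule.mkQ _ u) = dualMap hp u := fun u => rfl
  refine ⟨e, fun j => ?_⟩
  rw [add_zero]
  ext g
  constructor
  · rintro ⟨_, ⟨u, hu, rfl⟩, rfl⟩
    rintro i _ ⟨v, hv, rfl⟩
    change dualMap hp u (Submodule.mkQ _ v) ∈ _
    have hv' := mem_freeDeg_one.1 hv
    rw [dualMap_mk, show i + j = (i - 1) + (j + 1) by ring]
    exact sub_mem (ringDeg_mul (hv' 0) (phi_homogeneous hp hu 1))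
      (ringDeg_mul (hv' 1) (phi_homogeneous hp hu 0))
  · intro hg
    obtain ⟨u, rfl⟩ := dualMap_surjective hp g
    have h1 : (1 : NodeRing k) ∈ ringDeg k 0 := ⟨1, by simpa using C_mem (1 : k), map_one π⟩
    obtain ⟨e1, e0⟩ := dualMap_basis hp u
    -- The values of the form on the basis vectors, of degree one, are up to sign the entries of `φ
    -- u`. So `φ u` is homogeneous and `u` can be replaced by a homogeneous vector.
    have m1 := hg 1 (Submodule.mkQ _ ![1, 0])
      ⟨_, mem_freeDeg_one.2 (by
        rw [sub_self]; exact Fin.forall_fin_two.2 ⟨h1, zero_mem _⟩), rfl⟩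
    have m0 := hg 1 (Submodule.mkQ _ ![0, 1])
      ⟨_, mem_freeDeg_one.2 (by
        rw [sub_self]; exact Fin.forall_fin_two.2 ⟨zero_mem _, h1⟩), rfl⟩
    rw [e1, add_comm] at m1
    rw [e0, add_comm, neg_mem_iff] at m0
    obtain ⟨u', hu', h⟩ := phi_exists_homogeneous hp (Fin.forall_fin_two.2 ⟨m0, m1⟩)
    exact ⟨Submodule.mkQ _ u', ⟨u', hu', rfl⟩, dualMap_congr hp h⟩

end GradedMaps

/-! ### Separating the cokernels by linear parts. -/

section NonIsomorphic

variable {k : Type u} [Field k]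

local notation "π" => Ideal.Quotient.mk (Ideal.span {cubic k})

/-- The tangent vector `c` at the vertex of the cone, as a ring map `R → k[ε]`. -/
def tangent (c : Fin 3 → k) : NodeRing k →+* TrivSqZeroExt k k :=
  evalHom k (fun i => TrivSqZeroExt.inr (c i)) (by
    simp [cubic, pow_succ, mul_assoc])

lemma tangent_mk (c : Fin 3 → k) (s : PolyRing k) : tangent c (π s) =
    aeval (fun i => (TrivSqZeroExt.inr (c i) : TrivSqZeroExt k k)) s := rfl

/-- The value at the vertex of the cone. -/
def vertex : NodeRing k →+* k :=
  evalHom k (fun _ => 0) (by simp [cubic])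

lemma vertex_mk (s : PolyRing k) : vertex (π s) = constantCoeff s := by
  change aeval (fun _ => (0 : k)) s = _
  rw [show (fun _ : Fin 3 => (0 : k)) = 0 from rfl, aeval_zero]
  simp

lemma fst_tangent (c : Fin 3 → k) (r : NodeRing k) : (tangent c r).fst = vertex r := by
  obtain ⟨s, rfl⟩ := Ideal.Quotient.mk_surjective r
  change (TrivSqZeroExt.fstHom k k k).comp (aeval _) s = aeval _ s
  congr 1
  ext i
  simp

/-- The coefficient matrix of the linear parts of a matrix in the direction `c`. -/
def linPart (c : Fin 3 → k) (A : Matrix (Fin 2) (Fin 2) (PolyRing k)) : Matrix (Fin 2) (Fin 2) k :=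
  A.map fun s => (tangent c (π s)).snd

/-- An isomorphism of cokernels of minimal matrices induces an equivalence of the linear parts. -/
lemma exists_linPart {A B : Matrix (Fin 2) (Fin 2) (PolyRing k)}
    (hA : ∀ i j, constantCoeff (A i j) = 0) (hB : ∀ i j, constantCoeff (B i j) = 0)
    (e : Coker A ≃ₗ[NodeRing k] Coker B) :
    ∃ P P' : Matrix (Fin 2) (Fin 2) k, P * P' = 1 ∧
      ∀ c, ∃ Q, P * linPart c A = linPart c B * Q := by
  obtain ⟨P, hP⟩ := Module.projective_lifting_property
    (LinearMap.range (matMap B)).mkQ (e.toLinearMap.comp (LinearMap.range (matMap A)).mkQ)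
    (Submodule.mkQ_surjective _)
  obtain ⟨P', hP'⟩ := Module.projective_lifting_property
    (LinearMap.range (matMap A)).mkQ (e.symm.toLinearMap.comp (LinearMap.range (matMap B)).mkQ)
    (Submodule.mkQ_surjective _)
  have hlift : ∀ T : (Fin 2 → NodeRing k) →ₗ[NodeRing k] (Fin 2 → NodeRing k),
      (LinearMap.range (matMap B)).mkQ.comp T = 0 →
      ∃ Q : (Fin 2 → NodeRing k) →ₗ[NodeRing k] (Fin 2 → NodeRing k), T = (matMap B).comp Q := by
    intro T hT
    have hT' : ∀ x, T x ∈ LinearMap.range (matMap B) := fun x => by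
      rw [← Submodule.Quotient.mk_eq_zero]
      exact LinearMap.congr_fun hT x
    obtain ⟨Q, hQ⟩ := Module.projective_lifting_property (matMap B).rangeRestrict
      (T.codRestrict _ hT') (matMap B).surjective_rangeRestrict
    refine ⟨Q, LinearMap.ext fun x => ?_⟩
    exact (congrArg Subtype.val (LinearMap.congr_fun hQ x)).symm
  obtain ⟨Q, hQ⟩ := hlift (P.comp (matMap A)) (by
    rw [← LinearMap.comp_assoc, hP]
    refine LinearMap.ext fun x => ?_
    change e (Submodule.mkQ _ (matMap A x)) = 0
    rw [Submodule.mkQ_apply, (Submodule.Quotient.mk_eq_zero _).2 (LinearMap.mem_range_self _ x),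
      map_zero])
  -- `P P' - 1` factors through `B`, which vanishes at the vertex, so `P` is invertible there.
  obtain ⟨Q', hQ'⟩ := hlift (P.comp P' - LinearMap.id) (by
    rw [LinearMap.comp_sub, ← LinearMap.comp_assoc, hP, LinearMap.comp_assoc, hP']
    ext1 x
    simp)
  have hmat : ∀ C : Matrix (Fin 2) (Fin 2) (PolyRing k),
      LinearMap.toMatrix' (matMap C) = C.map π := fun C => by
    rw [matMap, ← Matrix.toLin'_apply', LinearMap.toMatrix'_toLin']
  have h1 := congrArg LinearMap.toMatrix' hQ
  have h2 := congrArg LinearMap.toMatrix' hQ'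
  rw [LinearMap.toMatrix'_comp, LinearMap.toMatrix'_comp, hmat, hmat] at h1
  rw [map_sub, LinearMap.toMatrix'_comp, LinearMap.toMatrix'_comp, hmat, LinearMap.toMatrix'_id]
    at h2
  refine ⟨(LinearMap.toMatrix' P).map vertex, (LinearMap.toMatrix' P').map vertex, ?_, fun c =>
    ⟨(LinearMap.toMatrix' Q).map vertex, ?_⟩⟩
  · have h3 := congrArg (fun N : Matrix (Fin 2) (Fin 2) (NodeRing k) => N.map vertex) h2
    have h4 : (B.map π).map vertex = (0 : Matrix (Fin 2) (Fin 2) k) := by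
      ext i j
      simp only [Matrix.map_apply, vertex_mk, hB, Matrix.zero_apply]
    simp only [Matrix.map_mul, h4, zero_mul] at h3
    rw [← Matrix.map_mul]
    ext i j
    have h5 := congrFun (congrFun h3 i) j
    simp only [Matrix.map_apply, Matrix.sub_apply, map_sub, Matrix.zero_apply, sub_eq_zero] at h5
    rw [Matrix.map_apply, h5]
    by_cases hij : i = j
    · subst hij; simp
    · simp [Matrix.one_apply_ne hij]
  · ext i j
    -- Compare the `ε`-parts of `P A = B Q`: as `A` and `B` vanish at the vertex, only the values of
    -- `P` and `Q` there contribute.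
    have h3 := congrArg (fun N : Matrix (Fin 2) (Fin 2) (NodeRing k) => (tangent c (N i j)).snd) h1
    have hA0 : ∀ i j, vertex (π (A i j)) = 0 := fun i j => by rw [vertex_mk, hA]
    have hB0 : ∀ i j, vertex (π (B i j)) = 0 := fun i j => by rw [vertex_mk, hB]
    simp only [Matrix.mul_apply, map_sum, map_mul, TrivSqZeroExt.snd_sum, TrivSqZeroExt.snd_mul,
      fst_tangent, Matrix.map_apply, hA0, hB0, MulOpposite.op_zero, zero_smul, zero_mul, add_zero,
      zero_add, smul_eq_mul, MulOpposite.smul_eq_mul_unop, MulOpposite.unop_op] at h3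
    simpa only [Matrix.mul_apply, linPart, Matrix.map_apply] using h3

lemma linPart_phi {p : ℙ k (Fin 3 → k)} (hp : p ∈ curve k) (c : Fin 3 → k) :
    linPart c (phi p) = !![eval c (phi p 0 0), 0; eval c (phi p 1 0), 0] := by
  rcases eq_infPt_or_affPt hp with rfl | ⟨a, b, hab, rfl⟩
  · rw [phi_infPt]
    ext i j
    fin_cases i <;> fin_cases j <;> simp [linPart, phiInf, tangent_mk, sq]
  · rw [phi_affPt]
    ext i j
    fin_cases i <;> fin_cases j <;>
      simp [linPart, phiAff, tangent_mk, sq, mul_assoc, TrivSqZeroExt.algebraMap_eq_inl,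
        mul_comm (c 2)]

lemma linPart_psi {p : ℙ k (Fin 3 → k)} (hp : p ∈ curve k) (c : Fin 3 → k) :
    linPart c (psi p) = !![0, 0; -eval c (phi p 1 0), eval c (phi p 0 0)] := by
  have h : ∀ i j, (tangent c (π (phi p i j))).snd =
      !![eval c (phi p 0 0), 0; eval c (phi p 1 0), 0] i j := fun i j => by
    rw [← linPart_phi hp c]; rfl
  obtain ⟨e00, e01, e10, e11⟩ := psi_apply p
  ext i j
  fin_cases i <;> fin_cases j <;>
    simp [linPart, e00, e01, e10, e11, h]

/-- The linear entries of `φ_p` cut out exactly the point `p`. -/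
lemma eq_of_eval_phi {p q : ℙ k (Fin 3 → k)} (hp : p ∈ curve k) (hq : q ∈ curve k)
    (h₀ : eval q.rep (phi p 0 0) = 0) (h₁ : eval q.rep (phi p 1 0) = 0) : p = q := by
  rcases eq_infPt_or_affPt hp with rfl | ⟨a, b, hab, rfl⟩ <;>
    rcases eq_infPt_or_affPt hq with rfl | ⟨a', b', hab', rfl⟩
  · rfl
  · obtain ⟨c, hc, h⟩ := affPt_rep a' b'
    simp [phi_infPt, phiInf, h, hc] at h₁
  · obtain ⟨c, hc, h⟩ := infPt_rep k
    simp [phi_affPt, phiAff, h, hc] at h₁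
  · obtain ⟨c, hc, h⟩ := affPt_rep a' b'
    simp only [phi_affPt, phiAff, h, Matrix.of_apply, Matrix.cons_val', Matrix.cons_val_zero,
      Matrix.cons_val_one, Matrix.cons_val, Matrix.cons_val_fin_one, map_sub, map_mul, eval_X,
      eval_C] at h₀ h₁
    have e₀ : a = a' := mul_left_cancel₀ hc (by linear_combination -h₀)
    have e₁ : b = b' := mul_left_cancel₀ hc (by linear_combination -h₁)
    rw [e₀, e₁]

lemma eval_phi_self {p : ℙ k (Fin 3 → k)} (hp : p ∈ curve k) :
    eval p.rep (phi p 0 0) = 0 ∧ eval p.rep (phi p 1 0) = 0 := by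
  rcases eq_infPt_or_affPt hp with rfl | ⟨a, b, hab, rfl⟩
  · obtain ⟨c, hc, h⟩ := infPt_rep k
    simp [phi_infPt, phiInf, h]
  · obtain ⟨c, hc, h⟩ := affPt_rep a b
    simp [phi_affPt, phiAff, h, mul_comm]

lemma constantCoeff_psi {p : ℙ k (Fin 3 → k)} (hp : p ∈ curve k) (i j : Fin 2) :
    constantCoeff (psi p i j) = 0 := by
  obtain ⟨e00, e01, e10, e11⟩ := psi_apply p
  fin_cases i <;> fin_cases j <;> simp [e00, e01, e10, e11, constantCoeff_phi hp]

lemma eq_zero_of_mul_eq_zero {P P' A : Matrix (Fin 2) (Fin 2) k} (h : P * P' = 1)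
    (hA : P * A = 0) : A = 0 := by
  rw [← one_mul A, ← mul_eq_one_comm.1 h, mul_assoc, hA, mul_zero]

/-- In the direction of `q` the linear part of `φ_q` vanishes. Since `P` is invertible, so does that
of `φ_p`, which forces `p = q`. -/
lemma isEmpty_phi_phi {p q : ℙ k (Fin 3 → k)} (hp : p ∈ curve k) (hq : q ∈ curve k) (hpq : p ≠ q) :
    IsEmpty (Coker (phi p) ≃ₗ[NodeRing k] Coker (phi q)) := by
  refine ⟨fun e => hpq ?_⟩
  obtain ⟨P, P', hP, h⟩ := exists_linPart (constantCoeff_phi hp) (constantCoeff_phi hq) e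
  obtain ⟨Q, hQ⟩ := h q.rep
  have h0 : linPart q.rep (phi q) = 0 := by
    rw [linPart_phi hq, (eval_phi_self hq).1, (eval_phi_self hq).2]
    ext i j
    fin_cases i <;> fin_cases j <;> rfl
  rw [h0, zero_mul] at hQ
  have h1 := eq_zero_of_mul_eq_zero hP hQ
  rw [linPart_phi hp] at h1
  exact eq_of_eval_phi hp hq (congrFun (congrFun h1 0) 0) (congrFun (congrFun h1 1) 0)

lemma isEmpty_psi_psi {p q : ℙ k (Fin 3 → k)} (hp : p ∈ curve k) (hq : q ∈ curve k) (hpq : p ≠ q) :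
    IsEmpty (Coker (psi p) ≃ₗ[NodeRing k] Coker (psi q)) := by
  refine ⟨fun e => hpq ?_⟩
  obtain ⟨P, P', hP, h⟩ := exists_linPart (constantCoeff_psi hp) (constantCoeff_psi hq) e
  obtain ⟨Q, hQ⟩ := h q.rep
  have h0 : linPart q.rep (psi q) = 0 := by
    rw [linPart_psi hq, (eval_phi_self hq).1, (eval_phi_self hq).2, neg_zero]
    ext i j
    fin_cases i <;> fin_cases j <;> rfl
  rw [h0, zero_mul] at hQ
  have h1 := eq_zero_of_mul_eq_zero hP hQ
  rw [linPart_psi hp] at h1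
  exact eq_of_eval_phi hp hq (congrFun (congrFun h1 1) 1)
    (neg_eq_zero.1 (congrFun (congrFun h1 1) 0))

/-- The top row of `ψ_q` has no linear part, while the linear column of `φ_p` takes all values in
`k²`. So the first row of `P` would vanish. -/
lemma isEmpty_phi_psi {p q : ℙ k (Fin 3 → k)} (hp : p ∈ curve k) (hq : q ∈ curve k) :
    IsEmpty (Coker (phi p) ≃ₗ[NodeRing k] Coker (psi q)) := by
  refine ⟨fun e => ?_⟩
  obtain ⟨P, P', hP, h⟩ := exists_linPart (constantCoeff_phi hp) (constantCoeff_psi hq) e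
  have hrow : ∀ x y : k, P 0 0 * x + P 0 1 * y = 0 := by
    intro x y
    obtain ⟨c, hx, hy⟩ := exists_eval_phi hp x y
    obtain ⟨Q, hQ⟩ := h c
    rw [linPart_phi hp, linPart_psi hq, hx, hy] at hQ
    have h1 := congrFun (congrFun hQ 0) 0
    simpa [Matrix.mul_apply, Fin.sum_univ_two] using h1
  have h2 := congrFun (congrFun hP 0) 0
  rw [Matrix.mul_apply, Fin.sum_univ_two, hrow] at h2
  simp at h2

end NonIsomorphic

end SimpleNode

end

theorem mainTheorem5 (k : Type*) [Field k] :
    -- (1) `(φ_p, ψ_p)` is a graded matrix factorization of `f` for every `p ∈ V(f)`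
    (∀ p ∈ SimpleNode.curve k,
      SimpleNode.IsGradedMatrixFactorization (SimpleNode.cubic k) 3 ![1, 1] ![2, 3]
        (SimpleNode.phi p) (SimpleNode.psi p)) ∧
    -- (2) two-generated non-free graded MCM modules are on the list, up to shift
    (∀ (M : Type*) [AddCommGroup M] [Module (SimpleNode.NodeRing k) M]
      (gr : ℤ → AddSubgroup M),
      SimpleNode.IsGradedMCM (k := k) gr →
      (⊤ : Submodule (SimpleNode.NodeRing k) M).spanFinrank = 2 →
      ¬ Module.Free (SimpleNode.NodeRing k) M →
      (∃ p ∈ SimpleNode.curveReg k, ∃ d : ℤ,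
        SimpleNode.GradedIso k gr (SimpleNode.cokerPhiDeg p) d) ∨
      (∃ p ∈ SimpleNode.curveReg k, ∃ d : ℤ,
        SimpleNode.GradedIso k gr (SimpleNode.cokerPsiDeg p) d) ∨
      (∃ d : ℤ, SimpleNode.GradedIso k gr
        (SimpleNode.cokerPhiDeg (SimpleNode.singularPt k)) d) ∨
      (∃ d : ℤ, SimpleNode.GradedIso k gr
        (SimpleNode.cokerPsiDeg (SimpleNode.singularPt k)) d)) ∧
    -- (3) the modules on the list are pairwise non-isomorphic, even as ungraded modules
    (∀ p ∈ SimpleNode.curve k, ∀ q ∈ SimpleNode.curve k,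
      (p ≠ q → IsEmpty (SimpleNode.Coker (SimpleNode.phi p) ≃ₗ[SimpleNode.NodeRing k]
        SimpleNode.Coker (SimpleNode.phi q))) ∧
      (p ≠ q → IsEmpty (SimpleNode.Coker (SimpleNode.psi p) ≃ₗ[SimpleNode.NodeRing k]
        SimpleNode.Coker (SimpleNode.psi q))) ∧
      IsEmpty (SimpleNode.Coker (SimpleNode.phi p) ≃ₗ[SimpleNode.NodeRing k]
        SimpleNode.Coker (SimpleNode.psi q))) ∧
    -- (4) all modules on the list have rank one
    (∀ p ∈ SimpleNode.curve k,
      Module.rank (SimpleNode.NodeRing k) (SimpleNode.Coker (SimpleNode.phi p)) = 1 ∧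
      Module.rank (SimpleNode.NodeRing k) (SimpleNode.Coker (SimpleNode.psi p)) = 1) ∧
    -- (5) `Coker ψ_p`, shifted by two, is the first syzygy, and `Coker ψ_p` is the dual,
    -- of `Coker φ_p`
    (∀ p ∈ SimpleNode.curveReg k,
      SimpleNode.IsFirstSyzygy k (SimpleNode.cokerPsiDeg p) (SimpleNode.cokerPhiDeg p) 2 ∧
      SimpleNode.GradedIso k (SimpleNode.cokerPsiDeg p)
        (SimpleNode.dualDeg k (SimpleNode.cokerPhiDeg p)) 0) := by
  open SimpleNode in
  refine ⟨fun p hp => isGradedMatrixFactorization hp, fun M _ _ gr hM h2 hfree => ?_,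
    fun p hp q hq => ⟨isEmpty_phi_phi hp hq, isEmpty_psi_psi hp hq, isEmpty_phi_psi hp hq⟩,
    fun p hp => rank_coker_phi_psi hp,
    fun p hp => ⟨isFirstSyzygy hp.1, gradedIso_dual hp.1⟩⟩
  rcases SimpleNode.classification hM h2 hfree with ⟨p, hp, d, hd⟩ | ⟨p, hp, d, hd⟩
  · by_cases hs : p = SimpleNode.singularPt k
    · exact Or.inr (Or.inr (Or.inl ⟨d, hs ▸ hd⟩))
    · exact Or.inl ⟨p, ⟨hp, hs⟩, d, hd⟩
  · by_cases hs : p = SimpleNode.singularPt k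
    · exact Or.inr (Or.inr (Or.inr ⟨d, hs ▸ hd⟩))
    · exact Or.inr (Or.inl ⟨p, ⟨hp, hs⟩, d, hd⟩)
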